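/- **Theorem.** Work on the word RAM with $w$-bit words and unit-cost arithmetic (including multiplication and integer division), bitwise, shift, comparison and memory-access instructions. There are a single program $P$ and absolute constants $c,a\in\mathbb N$ such that the following holds. Let $k\ge 0$ be an integer, let $S=S[0]S[1]\cdots S[n-1]$ be a string of length $n\ge 1$ over an alphabet $\{0,1,\ldots,\sigma-1\}$, and let $m$ be the largest number of occurrences of a character in $S$. Let the word size satisfy $w\ge a(\lfloor\log_2 n\rfloor+1)$ and $\sigma\le 2^w$. Then there is a bit string $D$ (the index) with $$|D|\ \le\ c\cdot 4^k\, n\, m\left(\frac{n}{m}\right)^{1/2^{2^k}}\ \text{bits}$$ such that, for all $0\le l\le r<n$, the program $P$, started with $l,r,n,w$ in registers, with read-only random access to the string $S$ (one character per word) and to the index $D$ (packed into words), and with a zeroed working memory, halts after at most $c\cdot 2^k$ steps and outputs a mode of the multiset $\{S[l],S[l+1],\ldots,S[r]\}$, that is, an element whose multiplicity in this multiset is maximum. In short: in addition to the string $S$, a data structure of ${\rm O}\left(4^k nm\left(\frac nm\right)^{1/2^{2^k}}\right)$ bits solves the range mode problem in ${\rm O}(2^k)$ time, with constants that do not depend on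 $n$, $m$, $k$ or the string. -/

import Mathlib

namespace RangeMode

/-! Modes of multisets and of substrings. -/

/-- `x` is a mode of the multiset `M`: it belongs to `M` and no element has larger multiplicity. -/
def IsMode {α : Type} [DecidableEq α] (M : Multiset α) (x : α) : Prop :=
  x ∈ M ∧ ∀ y, M.count y ≤ M.count x

/-- The multiset of the characters `S[l], S[l+1], …, S[r]`. -/
def substring {α : Type} {n : ℕ} (S : Fin n → α) (l r : Fin n) : Multiset α :=
  (Finset.Icc l r).val.map S

/-- The frequency of a most frequent character of the whole string `S`. -/
def maxFreq {α : Type} [DecidableEq α] {n : ℕ} (S : Fin n → α) : ℕ :=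
  Finset.univ.sup fun i => (Finset.univ.val.map S).count (S i)

/-! The word RAM with words of `w` bits.  A machine has a read-only string (one character per
word), a read-only index (a bit string, packed into words), registers, and a read-write working
memory of `2 ^ w` words.  Programs mention neither `w` nor the length of the inputs. -/

/-- Unit-cost operations on words. -/
inductive BinOp where
  | add | sub | mul | div | mod | and | or | xor | shl | shr | lt | eq

/-- All operations are the usual ones on unsigned `w`-bit words: arithmetic is modulo `2 ^ w`,
division is integer division, the result of a comparison is `1` or `0`. -/
def BinOp.eval {w : ℕ} : BinOp → BitVec w → BitVec w → BitVec w
  | .add, x, y => x + y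
  | .sub, x, y => x - y
  | .mul, x, y => x * y
  | .div, x, y => x / y
  | .mod, x, y => x % y
  | .and, x, y => x &&& y
  | .or,  x, y => x ||| y
  | .xor, x, y => x ^^^ y
  | .shl, x, y => x <<< y
  | .shr, x, y => x >>> y
  | .lt,  x, y => if x.toNat < y.toNat then BitVec.ofNat w 1 else BitVec.ofNat w 0
  | .eq,  x, y => if x = y then BitVec.ofNat w 1 else BitVec.ofNat w 0

/-- Expressions: constants, registers, operations, and reads from the working memory, from the
string and from the index at a computed address. -/
inductive Expr where
  | const (c : ℕ)
  | reg (x : ℕ)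
  | op (o : BinOp) (e₁ e₂ : Expr)
  | readMem (e : Expr)
  | readStr (e : Expr)
  | readIdx (e : Expr)

/-- Evaluating an expression takes one step per node. -/
def Expr.cost : Expr → ℕ
  | .const _ => 1
  | .reg _ => 1
  | .op _ e₁ e₂ => e₁.cost + e₂.cost + 1
  | .readMem e => e.cost + 1
  | .readStr e => e.cost + 1
  | .readIdx e => e.cost + 1

/-- Programs. -/
inductive Program where
  | skip
  | set (x : ℕ) (e : Expr)
  | store (addr e : Expr)
  | seq (p q : Program)
  | cond (e : Expr) (p q : Program)
  | loop (e : Expr) (p : Program)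

/-- The changing part of a machine: its registers and its working memory. -/
structure State (w : ℕ) where
  reg : ℕ → BitVec w
  mem : BitVec w → BitVec w

/-- The word number `i` of a string of length `n` over the alphabet `{0, …, σ - 1}`, stored one
character per word. -/
def strWord (w : ℕ) {n σ : ℕ} (S : Fin n → Fin σ) (i : ℕ) : BitVec w :=
  if h : i < n then BitVec.ofNat w (S ⟨i, h⟩).val else 0

/-- The word number `i` of a bit string packed into words of `w` bits: bit `j` of the word is bit
`i * w + j` of the string, and the last word is padded with zeros. -/
def idxWord (w : ℕ) (D : List Bool) (i : ℕ) : BitVec w :=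
  BitVec.ofFnLE fun j : Fin w => D.getD (i * w + j.val) false

section Semantics

variable {w n σ : ℕ} (S : Fin n → Fin σ) (D : List Bool)

/-- The value of an expression, for the string `S`, the index `D` and a state. -/
def Expr.eval (s : State w) : Expr → BitVec w
  | .const c => BitVec.ofNat w c
  | .reg x => s.reg x
  | .op o e₁ e₂ => o.eval (Expr.eval s e₁) (Expr.eval s e₂)
  | .readMem e => s.mem (Expr.eval s e)
  | .readStr e => strWord w S (Expr.eval s e).toNat
  | .readIdx e => idxWord w D (Expr.eval s e).toNat

/-- `Exec S D p s t s'`: started in the state `s`, with read-only string `S` and index `D`, the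
program `p` halts after exactly `t` steps in the state `s'`.  A condition holds if its value is
not `0`. -/
inductive Exec : Program → State w → ℕ → State w → Prop
  | skip (s : State w) : Exec .skip s 1 s
  | set (x : ℕ) (e : Expr) (s : State w) :
      Exec (.set x e) s (e.cost + 1)
        { s with reg := Function.update s.reg x (e.eval S D s) }
  | store (a e : Expr) (s : State w) :
      Exec (.store a e) s (a.cost + e.cost + 1)
        { s with mem := Function.update s.mem (a.eval S D s) (e.eval S D s) }
  | seq {p q : Program} {s s' s'' : State w} {t t' : ℕ} :
      Exec p s t s' → Exec q s' t' s'' → Exec (.seq p q) s (t + t') s''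
  | condTrue {e : Expr} {p q : Program} {s s' : State w} {t : ℕ} :
      e.eval S D s ≠ 0 → Exec p s t s' → Exec (.cond e p q) s (e.cost + 1 + t) s'
  | condFalse {e : Expr} {p q : Program} {s s' : State w} {t : ℕ} :
      e.eval S D s = 0 → Exec q s t s' → Exec (.cond e p q) s (e.cost + 1 + t) s'
  | loopStop {e : Expr} {p : Program} {s : State w} :
      e.eval S D s = 0 → Exec (.loop e p) s (e.cost + 1) s
  | loopStep {e : Expr} {p : Program} {s s' s'' : State w} {t t' : ℕ} :
      e.eval S D s ≠ 0 → Exec p s t s' → Exec (.loop e p) s' t' s'' →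
      Exec (.loop e p) s (e.cost + 1 + t + t') s''

end Semantics

/-- The initial state for the query `[l, r]`: registers `0, 1, 2, 3` hold `l`, `r`, the length `n`
of the string and the word size `w`; everything else is zero. -/
def initState (w n l r : ℕ) : State w where
  reg := fun x =>
    if x = 0 then BitVec.ofNat w l
    else if x = 1 then BitVec.ofNat w r
    else if x = 2 then BitVec.ofNat w n
    else if x = 3 then BitVec.ofNat w w
    else 0
  mem := fun _ => 0

/-- With the index `D` for the string `S`, the program `P` answers every range mode query on `S`
within `T` steps on the `w`-bit word RAM.  The answer, in register `0`, is a mode of the range. -/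
def AnswersRangeMode (P : Program) (w : ℕ) {n σ : ℕ} (S : Fin n → Fin σ) (D : List Bool)
    (T : ℕ) : Prop :=
  ∀ l r : Fin n, l ≤ r →
    ∃ (t : ℕ) (s : State w), Exec S D P (initState w n l r) t s ∧ t ≤ T ∧
      ∃ x : Fin σ, IsMode (substring S l r) x ∧ (s.reg 0).toNat = x.val

end RangeMode

/-! Let `F a e` be the largest number of occurrences of a character in the window `[a, e)`. It is
monotone in the window and grows by at most one per added position. A query is answered by computing
`f = F a e` and then turning `f` into a position that holds a mode.

From the frequency to a position. The windows with `a + e = d` are nested, so those of frequency at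
least `f` are described by a threshold `curve F f d`, which moves by 0 or 1 when `d` grows by one
(`WindowFreq.le_iff_lt_curve`). It is therefore a rank in a bit sequence, and all thresholds
together take `O(nm)` bits. The smallest window of frequency at least `f` loses this property when
both its end positions are removed, so at least one end carries a character with `f` occurrences in
it; one bit per pair `(f, d)` tells which (`modePos_spec`).

Computing the frequency. The pairs `(a, e)` are cut into square cells of side `2 ^ x`. On an
antidiagonal the windows of different cells are nested, so there each maximum is attained by at most
one mixed cell; this leaves `O(mn / 2 ^ x)` mixed cells (`WindowFreq.mixed_injOn`, `mixedCount_le`).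
The first side is about `n / m`, with maxima read off from stored rows of `F`. Then only mixed cells
are refined, from `x` to about `3x / 4`, with a flag and the drop of the maximum (`x + 1` bits)
stored for each subcell; every such round costs `O(nm)` bits (`add_two_mul_le`). After at most `3 *
2 ^ k + 3` of these rounds, a last one goes directly to side 1. It costs `O(nm * 4 ^ x)` bits, where
`4 ^ x` is at most `64 * (n / m) ^ (1 / 2 ^ 2 ^ k)` (`four_pow_cellLog_le`). A query follows the
cell that contains `(a, e)` until it is no longer mixed; the number of the next cell comes from a
rank among the flags.

Ranks take constant time by a directory over blocks of about half of `log n` bits and a table of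
population counts, at the price of a constant factor in space (`Scheme.length_index_le`). Each level
takes constant time, and there are `O(2 ^ k)` levels. The working memory is never used. -/

namespace RangeMode

/-! ### Bit fields of a bit sequence -/

/-- The number whose binary digits are the `len` bits of `z` starting at position `p`. -/
def bitsNat (z : ℕ → Bool) (p len : ℕ) : ℕ :=
  Nat.ofBits fun j : Fin len => z (p + j)

theorem testBit_bitsNat (z : ℕ → Bool) (p len j : ℕ) :
    (bitsNat z p len).testBit j = (decide (j < len) && z (p + j)) := by
  unfold bitsNat
  by_cases h : j < len
  · rw [Nat.testBit_ofBits_lt _ _ h]; simp [h]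
  · rw [Nat.testBit_ofBits_ge _ _ (not_lt.mp h)]; simp [h]

theorem bitsNat_lt (z : ℕ → Bool) (p len : ℕ) : bitsNat z p len < 2 ^ len :=
  Nat.ofBits_lt_two_pow _

theorem bitsNat_eq {z : ℕ → Bool} {p len v : ℕ} (hv : v < 2 ^ len)
    (h : ∀ j < len, z (p + j) = v.testBit j) : bitsNat z p len = v := by
  apply Nat.eq_of_testBit_eq
  intro j
  rw [testBit_bitsNat]
  by_cases hj : j < len
  · simp [hj, h j hj]
  · have : v < 2 ^ j := lt_of_lt_of_le hv (Nat.pow_le_pow_right (by norm_num) (not_lt.mp hj))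
    simp [hj, Nat.testBit_lt_two_pow this]

theorem bitsNat_congr {z z' : ℕ → Bool} {p p' len : ℕ}
    (h : ∀ j < len, z (p + j) = z' (p' + j)) : bitsNat z p len = bitsNat z' p' len :=
  bitsNat_eq (bitsNat_lt _ _ _) fun j hj => by rw [h j hj, testBit_bitsNat]; simp [hj]

theorem bitsNat_one (z : ℕ → Bool) (p : ℕ) : bitsNat z p 1 = (z p).toNat := by
  apply bitsNat_eq
  · cases z p <;> simp
  · intro j hj
    obtain rfl : j = 0 := by omega
    cases z p <;> simp

/-- The bits of an index as a total function. -/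
def bitAt (D : List Bool) (p : ℕ) : Bool := D.getD p false

theorem toNat_idxWord (w : ℕ) (D : List Bool) (i : ℕ) :
    (idxWord w D i).toNat = bitsNat (bitAt D) (i * w) w := by
  unfold idxWord bitsNat
  rw [BitVec.toNat_ofFnLE]; rfl

/-- A field of fewer than `w` bits meets at most two consecutive words. If `w` divides `p`, the
truncation modulo `2 ^ w` removes the second word; the final reduction removes what follows the
field. -/
theorem two_words (z : ℕ → Bool) {w p len : ℕ} (hlen : len < w) :
    ((bitsNat z (p / w * w) w >>> (p % w)) |||
      ((bitsNat z ((p / w + 1) * w) w) <<< (w - p % w)) % 2 ^ w) % 2 ^ len =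
      bitsNat z p len := by
  have hw : 0 < w := by omega
  have hm := Nat.mod_lt p hw
  have hp : p / w * w + p % w = p := by rw [mul_comm]; exact Nat.div_add_mod p w
  have hq : (p / w + 1) * w = p / w * w + w := by ring
  apply Nat.eq_of_testBit_eq
  intro j
  simp only [Nat.testBit_mod_two_pow, Nat.testBit_or, Nat.testBit_shiftRight,
    Nat.testBit_shiftLeft, testBit_bitsNat]
  by_cases hj : j < len
  · have hjw : j < w := by omega
    by_cases h : p % w + j < w
    · have h1 : ¬ (j ≥ w - p % w) := by omega
      have h2 : p / w * w + (p % w + j) = p + j := by omega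
      simp [hj, hjw, h, h1, h2]
    · have h1 : j ≥ w - p % w := by omega
      have h2 : (p / w + 1) * w + (j - (w - p % w)) = p + j := by omega
      have h3 : j - (w - p % w) < w := by omega
      simp [hj, hjw, h, h1, h2, h3]
  · simp [hj]

/-! ### Evaluation of expressions without overflow -/

/-- The registers of `s` hold the natural numbers `ρ`. -/
def State.Holds {w : ℕ} (s : State w) (ρ : ℕ → ℕ) : Prop := ∀ i, (s.reg i).toNat = ρ i

section

variable {w n σ : ℕ} (S : Fin n → Fin σ) (D : List Bool)

/-- If the registers hold `ρ`, the value of `e` is the natural number `v`. -/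
def Evals (ρ : ℕ → ℕ) (e : Expr) (v : ℕ) : Prop :=
  ∀ s : State w, s.Holds ρ → (e.eval S D s).toNat = v

variable {S D} {ρ : ℕ → ℕ} {e e' : Expr} {u v : ℕ}

theorem Evals.cast (h : Evals (w := w) S D ρ e u) (huv : u = v) : Evals (w := w) S D ρ e v :=
  huv ▸ h

theorem evals_const (c : ℕ) (h : c < 2 ^ w) : Evals (w := w) S D ρ (.const c) c := by
  intro s _
  simp [Expr.eval, Nat.mod_eq_of_lt h]

theorem evals_reg (i : ℕ) : Evals (w := w) S D ρ (.reg i) (ρ i) := fun _ hs => hs i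

theorem evals_reg_eq {i : ℕ} (h : ρ i = v) : Evals (w := w) S D ρ (.reg i) v := h ▸ evals_reg i

theorem Evals.add (h : Evals (w := w) S D ρ e u) (h' : Evals (w := w) S D ρ e' v)
    (hlt : u + v < 2 ^ w) : Evals (w := w) S D ρ (.op .add e e') (u + v) := by
  intro s hs
  simp [Expr.eval, BinOp.eval, h s hs, h' s hs, Nat.mod_eq_of_lt hlt]

theorem Evals.mul (h : Evals (w := w) S D ρ e u) (h' : Evals (w := w) S D ρ e' v)
    (hlt : u * v < 2 ^ w) : Evals (w := w) S D ρ (.op .mul e e') (u * v) := by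
  intro s hs
  simp [Expr.eval, BinOp.eval, h s hs, h' s hs, Nat.mod_eq_of_lt hlt]

theorem Evals.sub (h : Evals (w := w) S D ρ e u) (h' : Evals (w := w) S D ρ e' v)
    (hle : v ≤ u) : Evals (w := w) S D ρ (.op .sub e e') (u - v) := by
  intro s hs
  simp only [Expr.eval, BinOp.eval]
  rw [BitVec.toNat_sub_of_le (by rw [BitVec.le_def, h s hs, h' s hs]; exact hle), h s hs, h' s hs]

theorem Evals.div (h : Evals (w := w) S D ρ e u) (h' : Evals (w := w) S D ρ e' v) :
    Evals (w := w) S D ρ (.op .div e e') (u / v) := by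
  intro s hs
  simp [Expr.eval, BinOp.eval, h s hs, h' s hs]

theorem Evals.mod (h : Evals (w := w) S D ρ e u) (h' : Evals (w := w) S D ρ e' v) :
    Evals (w := w) S D ρ (.op .mod e e') (u % v) := by
  intro s hs
  simp [Expr.eval, BinOp.eval, h s hs, h' s hs]

theorem Evals.or (h : Evals (w := w) S D ρ e u) (h' : Evals (w := w) S D ρ e' v) :
    Evals (w := w) S D ρ (.op .or e e') (u ||| v) := by
  intro s hs
  simp [Expr.eval, BinOp.eval, h s hs, h' s hs]

theorem Evals.xor (h : Evals (w := w) S D ρ e u) (h' : Evals (w := w) S D ρ e' v) :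
    Evals (w := w) S D ρ (.op .xor e e') (u ^^^ v) := by
  intro s hs
  simp [Expr.eval, BinOp.eval, h s hs, h' s hs]

theorem Evals.shr (h : Evals (w := w) S D ρ e u) (h' : Evals (w := w) S D ρ e' v) :
    Evals (w := w) S D ρ (.op .shr e e') (u >>> v) := by
  intro s hs
  simp [Expr.eval, BinOp.eval, h s hs, h' s hs]

theorem Evals.shl_mod (h : Evals (w := w) S D ρ e u) (h' : Evals (w := w) S D ρ e' v) :
    Evals (w := w) S D ρ (.op .shl e e') (u <<< v % 2 ^ w) := by
  intro s hs
  simp [Expr.eval, BinOp.eval, h s hs, h' s hs]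

theorem Evals.shl (h : Evals (w := w) S D ρ e u) (h' : Evals (w := w) S D ρ e' v)
    (hlt : u * 2 ^ v < 2 ^ w) : Evals (w := w) S D ρ (.op .shl e e') (u * 2 ^ v) :=
  (h.shl_mod h').cast (by rw [Nat.shiftLeft_eq, Nat.mod_eq_of_lt hlt])

theorem Evals.readIdx (h : Evals (w := w) S D ρ e v) :
    Evals (w := w) S D ρ (.readIdx e) (bitsNat (bitAt D) (v * w) w) := by
  intro s hs
  simp [Expr.eval, h s hs, toNat_idxWord]

/-- The expression that reads `len` bits of the index, starting at position `p`. -/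
def bitsExpr (p len : Expr) : Expr :=
  .op .mod
    (.op .or (.op .shr (.readIdx (.op .div p (.reg 3))) (.op .mod p (.reg 3)))
      (.op .shl (.readIdx (.op .add (.op .div p (.reg 3)) (.const 1)))
        (.op .sub (.reg 3) (.op .mod p (.reg 3)))))
    (.op .shl (.const 1) len)

/-- The bound on `v` is strict because the modulus `2 ^ v` must itself fit into a word. -/
theorem Evals.bits (hw : ρ 3 = w) (h : Evals (w := w) S D ρ e u)
    (h' : Evals (w := w) S D ρ e' v) (hu : u + 1 < 2 ^ w) (hv : v < w) :
    Evals (w := w) S D ρ (bitsExpr e e') (bitsNat (bitAt D) u v) := by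
  have h3 : Evals (w := w) S D ρ (.reg 3) w := evals_reg_eq hw
  have h1 : Evals (w := w) S D ρ (.const 1) 1 := evals_const 1 (by omega)
  have hdiv : u / w ≤ u := Nat.div_le_self u w
  have hv2 : 1 * 2 ^ v < 2 ^ w := by
    rw [one_mul]; exact Nat.pow_lt_pow_right (by norm_num) hv
  have := (((h.div h3).readIdx.shr (h.mod h3)).or
    (((h.div h3).add h1 (by omega)).readIdx.shl_mod
      (h3.sub (h.mod h3) (Nat.mod_lt u (by omega)).le))).mod (h1.shl h' hv2)
  refine this.cast ?_
  rw [one_mul]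
  exact two_words _ hv

/-! ### Running programs -/

variable (S D)

/-- Started with registers `ρ`, the program `p` halts after exactly `t` steps with registers
`ρ'`. -/
def Runs (w : ℕ) {n σ : ℕ} (S : Fin n → Fin σ) (D : List Bool) (p : Program) (ρ : ℕ → ℕ) (t : ℕ)
    (ρ' : ℕ → ℕ) : Prop :=
  ∀ s : State w, s.Holds ρ → ∃ s', Exec S D p s t s' ∧ s'.Holds ρ'

variable {S D}

theorem Runs.set {x : ℕ} (h : Evals (w := w) S D ρ e v) :
    Runs w S D (.set x e) ρ (e.cost + 1) (Function.update ρ x v) := by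
  intro s hs
  refine ⟨_, Exec.set x e s, fun i => ?_⟩
  by_cases hi : i = x
  · subst hi; simp [h s hs]
  · simp [hi, hs i]

theorem Runs.seq {p q : Program} {t t' : ℕ} {ρ' ρ'' : ℕ → ℕ} (h : Runs w S D p ρ t ρ')
    (h' : Runs w S D q ρ' t' ρ'') : Runs w S D (.seq p q) ρ (t + t') ρ'' := by
  intro s hs
  obtain ⟨s', e1, hs'⟩ := h s hs
  obtain ⟨s'', e2, hs''⟩ := h' s' hs'
  exact ⟨s'', e1.seq e2, hs''⟩

theorem Runs.condTrue {p q : Program} {t : ℕ} {ρ' : ℕ → ℕ} (he : Evals (w := w) S D ρ e v)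
    (hv : v ≠ 0) (h : Runs w S D p ρ t ρ') :
    Runs w S D (.cond e p q) ρ (e.cost + 1 + t) ρ' := by
  intro s hs
  obtain ⟨s', e1, hs'⟩ := h s hs
  refine ⟨s', Exec.condTrue (fun h0 => hv ?_) e1, hs'⟩
  rw [← he s hs, h0]; simp

theorem Runs.condFalse {p q : Program} {t : ℕ} {ρ' : ℕ → ℕ} (he : Evals (w := w) S D ρ e 0)
    (h : Runs w S D q ρ t ρ') :
    Runs w S D (.cond e p q) ρ (e.cost + 1 + t) ρ' := by
  intro s hs
  obtain ⟨s', e1, hs'⟩ := h s hs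
  exact ⟨s', Exec.condFalse (BitVec.eq_of_toNat_eq (by rw [he s hs]; simp)) e1, hs'⟩

theorem Runs.loopStop {p : Program} (he : Evals (w := w) S D ρ e 0) :
    Runs w S D (.loop e p) ρ (e.cost + 1) ρ := by
  intro s hs
  exact ⟨s, Exec.loopStop (BitVec.eq_of_toNat_eq (by rw [he s hs]; simp)), hs⟩

theorem Runs.loopStep {p : Program} {t t' : ℕ} {ρ' ρ'' : ℕ → ℕ} (he : Evals (w := w) S D ρ e v)
    (hv : v ≠ 0) (h : Runs w S D p ρ t ρ') (h' : Runs w S D (.loop e p) ρ' t' ρ'') :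
    Runs w S D (.loop e p) ρ (e.cost + 1 + t + t') ρ'' := by
  intro s hs
  obtain ⟨s', e1, hs'⟩ := h s hs
  obtain ⟨s'', e2, hs''⟩ := h' s' hs'
  refine ⟨s'', Exec.loopStep (fun h0 => hv ?_) e1 e2, hs''⟩
  rw [← he s hs, h0]; simp

/-- Execution of a list of assignments. -/
def assigns : List (ℕ × Expr) → Program
  | [] => .skip
  | (x, e) :: l => .seq (.set x e) (assigns l)

/-- The number of steps of a list of assignments. -/
def assignsCost : List (ℕ × Expr) → ℕ
  | [] => 1
  | (_, e) :: l => e.cost + 1 + assignsCost l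

theorem runs_assigns_nil : Runs w S D (assigns []) ρ (assignsCost []) ρ :=
  fun s hs => ⟨s, Exec.skip s, hs⟩

theorem Runs.assigns_cons {x : ℕ} {l : List (ℕ × Expr)} {ρ' : ℕ → ℕ}
    (h : Evals (w := w) S D ρ e v)
    (h' : Runs w S D (assigns l) (Function.update ρ x v) (assignsCost l) ρ') :
    Runs w S D (assigns ((x, e) :: l)) ρ (assignsCost ((x, e) :: l)) ρ' :=
  (Runs.set h).seq h'

end

/-! ### Frequencies of windows -/

/-- The properties of the function that maps `a`, `e` to the frequency of a mode of the window
`[a, e)`, where `m` is the largest frequency. -/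
structure WindowFreq (F : ℕ → ℕ → ℕ) (m : ℕ) : Prop where
  mono : ∀ {a a' e e'}, a' ≤ a → e ≤ e' → F a e ≤ F a' e'
  succ_right : ∀ a e, F a (e + 1) ≤ F a e + 1
  succ_left : ∀ a e, F a e ≤ F (a + 1) e + 1
  empty : ∀ {a e}, e ≤ a → F a e = 0
  le : ∀ a e, F a e ≤ m

namespace WindowFreq

variable {F : ℕ → ℕ → ℕ} {m : ℕ} (hF : WindowFreq F m)
include hF

theorem add_right (a e k : ℕ) : F a (e + k) ≤ F a e + k := by
  induction k with
  | zero => simp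
  | succ k ih => have := hF.succ_right a (e + k); rw [← add_assoc]; omega

theorem add_left (a e k : ℕ) : F a e ≤ F (a + k) e + k := by
  induction k with
  | zero => simp
  | succ k ih => have := hF.succ_left (a + k) e; rw [← add_assoc a k 1]; omega

/-- From the empty window on, every new position raises the frequency by 0 or 1. Hence a row of `F`
can be stored as one bit per position and read by rank. -/
theorem count_steps (a N : ℕ) :
    Nat.count (fun e => F a e < F a (e + 1)) N = F a N := by
  induction N with
  | zero => simp [hF.empty (Nat.zero_le a)]
  | succ N ih =>
    rw [Nat.count_succ, ih]
    have h1 := hF.succ_right a N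
    have h2 : F a N ≤ F a (N + 1) := hF.mono le_rfl (Nat.le_succ N)
    split_ifs <;> omega

end WindowFreq

/-- The number of `a` such that the window `[a, d - a)` has a mode of frequency at least `f`. -/
def curve (F : ℕ → ℕ → ℕ) (f : ℕ) : ℕ → ℕ
  | 0 => 0
  | d + 1 => curve F f d + if f ≤ F (curve F f d) (d + 1 - curve F f d) then 1 else 0

theorem curve_eq_count (F : ℕ → ℕ → ℕ) (f d : ℕ) :
    curve F f d =
      Nat.count (fun d => f ≤ F (curve F f d) (d + 1 - curve F f d)) d := by
  induction d with
  | zero => simp [curve]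
  | succ d ih => rw [Nat.count_succ, ← ih, curve]

/-- From `d` to `d + 1` the window with a given start gains a position on the right, so good starts
stay good; and a start `a` can only be good for `d + 1` if `a - 1` was good for `d`. Only the start
equal to the old threshold is undecided, and this is the one that `curve` tests. -/
theorem WindowFreq.le_iff_lt_curve {F : ℕ → ℕ → ℕ} {m f : ℕ} (hF : WindowFreq F m) (hf : 0 < f)
    (d a : ℕ) : f ≤ F a (d - a) ↔ a < curve F f d := by
  induction d generalizing a with
  | zero =>
    have : F a (0 - a) = 0 := hF.empty (by omega)
    rw [this]; simp [curve]; omega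
  | succ d ih =>
    rcases lt_trichotomy a (curve F f d) with h | h | h
    · have h1 := (ih a).2 h
      have h2 : F a (d - a) ≤ F a (d + 1 - a) := hF.mono le_rfl (by omega)
      have : a < curve F f (d + 1) := by rw [curve]; omega
      exact iff_of_true (h1.trans h2) this
    · rw [curve, ← h]
      split_ifs with h' <;> simp [h']
    · have h1 : ¬ f ≤ F (a - 1) (d - (a - 1)) := fun hc => by
        have := (ih (a - 1)).1 hc; omega
      -- Both windows have the same right end, except for `a > d + 1`, where the first one is empty.
      have h2 : F a (d + 1 - a) ≤ F (a - 1) (d - (a - 1)) := by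
        by_cases had : a ≤ d + 1
        · exact hF.mono (by omega) (by omega)
        · rw [hF.empty (by omega : d + 1 - a ≤ a)]; omega
      have h3 : curve F f (d + 1) ≤ curve F f d + 1 := by
        rw [curve]; split_ifs <;> omega
      exact iff_of_false (by omega) (by omega)

/-! ### Cells -/

/-- The largest frequency of a window `[a, e)` with `a / 2 ^ x = c.1` and `e / 2 ^ x = c.2`. -/
def cellMax (F : ℕ → ℕ → ℕ) (x : ℕ) (c : ℕ × ℕ) : ℕ := F (c.1 * 2 ^ x) (c.2 * 2 ^ x + (2 ^ x - 1))

/-- The smallest frequency of a window `[a, e)` with `a / 2 ^ x = c.1` and `e / 2 ^ x = c.2`. -/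
def cellMin (F : ℕ → ℕ → ℕ) (x : ℕ) (c : ℕ × ℕ) : ℕ := F (c.1 * 2 ^ x + (2 ^ x - 1)) (c.2 * 2 ^ x)

/-- The cell of size `2 ^ x` that contains `(a, e)`. -/
def cellOf (x a e : ℕ) : ℕ × ℕ := (a / 2 ^ x, e / 2 ^ x)

/-- Several frequencies occur in the cell. -/
abbrev Mixed (F : ℕ → ℕ → ℕ) (x : ℕ) (c : ℕ × ℕ) : Prop := cellMin F x c < cellMax F x c

/-- The subcell number `p` of a cell that is split into `2 ^ g * 2 ^ g` subcells. -/
def subcell (g : ℕ) (c : ℕ × ℕ) (p : ℕ) : ℕ × ℕ :=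
  (c.1 * 2 ^ g + p / 2 ^ g % 2 ^ g, c.2 * 2 ^ g + p % 2 ^ g)

theorem div_mul_le_and (a x : ℕ) :
    a / 2 ^ x * 2 ^ x ≤ a ∧ a ≤ a / 2 ^ x * 2 ^ x + (2 ^ x - 1) := by
  have h1 := Nat.div_add_mod' a (2 ^ x)
  have h2 := Nat.mod_lt a (show 0 < 2 ^ x by positivity)
  omega

theorem div_two_pow_split {x y : ℕ} (h : y ≤ x) (a : ℕ) :
    a / 2 ^ x * 2 ^ (x - y) + a / 2 ^ y % 2 ^ (x - y) = a / 2 ^ y := by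
  have : a / 2 ^ x = a / 2 ^ y / 2 ^ (x - y) := by
    rw [Nat.div_div_eq_div_mul, ← pow_add]; congr 2; omega
  rw [this, Nat.div_add_mod']

theorem mul_add_mod_self {a v N : ℕ} (hv : v < N) : (a * N + v) % N = v := by
  rw [mul_comm, Nat.mul_add_mod, Nat.mod_eq_of_lt hv]

/-- The reductions in `subcell` discard `c`, so the number of a cell within its whole level can be
passed to it. -/
theorem subcell_mk {g c u v : ℕ} {p : ℕ × ℕ} (hu : u < 2 ^ g) (hv : v < 2 ^ g) :
    subcell g p ((c * 2 ^ g + u) * 2 ^ g + v) = (p.1 * 2 ^ g + u, p.2 * 2 ^ g + v) := by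
  have hg : 0 < 2 ^ g := by positivity
  unfold subcell
  have h1 : ((c * 2 ^ g + u) * 2 ^ g + v) % 2 ^ g = v := by
    rw [mul_add_mod_self hv]
  have h2 : ((c * 2 ^ g + u) * 2 ^ g + v) / 2 ^ g = c * 2 ^ g + u := by
    rw [add_comm, Nat.add_mul_div_right _ _ hg, Nat.div_eq_of_lt hv, zero_add]
  have h3 : (c * 2 ^ g + u) % 2 ^ g = u := by
    rw [mul_add_mod_self hu]
  rw [h1, h2, h3]

section

variable {F : ℕ → ℕ → ℕ} {m : ℕ} (hF : WindowFreq F m)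
include hF

theorem WindowFreq.cellMin_le (x a e : ℕ) : cellMin F x (cellOf x a e) ≤ F a e :=
  hF.mono (div_mul_le_and a x).2 (div_mul_le_and e x).1

theorem WindowFreq.le_cellMax (x a e : ℕ) : F a e ≤ cellMax F x (cellOf x a e) :=
  hF.mono (div_mul_le_and a x).1 (div_mul_le_and e x).2

theorem WindowFreq.eq_cellMax {x a e : ℕ} (h : ¬ Mixed F x (cellOf x a e)) :
    F a e = cellMax F x (cellOf x a e) := by
  have h1 := hF.cellMin_le x a e
  have h2 := hF.le_cellMax x a e
  unfold Mixed at h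
  omega

/-- The largest window of a cell has `2 ^ x - 1` more positions on each side than the smallest one.
-/
theorem WindowFreq.cellMax_le (x : ℕ) (c : ℕ × ℕ) :
    cellMax F x c ≤ cellMin F x c + 2 * (2 ^ x - 1) := by
  have h1 := hF.add_right (c.1 * 2 ^ x) (c.2 * 2 ^ x) (2 ^ x - 1)
  have h2 := hF.add_left (c.1 * 2 ^ x) (c.2 * 2 ^ x) (2 ^ x - 1)
  unfold cellMax cellMin
  omega

/-- The small cell lies inside the large one. This makes the truncated subtraction in `Scheme.delta`
a true difference, so the descent can undo it. -/
theorem WindowFreq.cellMax_anti {x y : ℕ} (h : y ≤ x) (a e : ℕ) :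
    cellMax F y (cellOf y a e) ≤ cellMax F x (cellOf x a e) := by
  have key : ∀ b, b / 2 ^ x * 2 ^ x ≤ b / 2 ^ y * 2 ^ y ∧
      b / 2 ^ y * 2 ^ y + (2 ^ y - 1) ≤ b / 2 ^ x * 2 ^ x + (2 ^ x - 1) := by
    intro b
    have hxy : 2 ^ x = 2 ^ (x - y) * 2 ^ y := by rw [← pow_add]; congr 1; omega
    have hs := div_two_pow_split h b
    have hy : 0 < 2 ^ y := by positivity
    have hg : 0 < 2 ^ (x - y) := by positivity
    have hlt := Nat.mod_lt (b / 2 ^ y) hg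
    set q := b / 2 ^ x
    set r := b / 2 ^ y % 2 ^ (x - y)
    rw [← hs, hxy]
    constructor
    · nlinarith [Nat.zero_le (r * 2 ^ y)]
    · have h1 : (r + 1) * 2 ^ y ≤ 2 ^ (x - y) * 2 ^ y := Nat.mul_le_mul_right _ hlt
      have h2 : (q * 2 ^ (x - y) + r) * 2 ^ y = q * (2 ^ (x - y) * 2 ^ y) + r * 2 ^ y := by ring
      have h3 : (r + 1) * 2 ^ y = r * 2 ^ y + 2 ^ y := by ring
      omega
  exact hF.mono (key a).1 (key e).2

/-- The second maximum is at least `F a e`, hence at least the minimum of the first cell. So `x + 1`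
bits suffice for a drop. -/
theorem WindowFreq.sub_cellMax_lt (x y a e : ℕ) :
    cellMax F x (cellOf x a e) - cellMax F y (cellOf y a e) < 2 ^ (x + 1) := by
  have h1 := hF.cellMax_le x (cellOf x a e)
  have h2 := hF.cellMin_le x a e
  have h3 := hF.le_cellMax y a e
  have h4 : 2 ^ (x + 1) = 2 * 2 ^ x := by ring
  have h5 : 0 < 2 ^ x := by positivity
  omega

/-- On an antidiagonal, moving to a later start shrinks the windows so much that the largest window
of the new cell lies in the smallest window of the old one. Since the old cell is mixed, its maximum
is strictly larger. -/
theorem WindowFreq.mixed_injOn (x : ℕ) {c c' : ℕ × ℕ} (hc : Mixed F x c) (hc' : Mixed F x c')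
    (h1 : cellMax F x c = cellMax F x c') (h2 : c.1 + c.2 = c'.1 + c'.2) : c = c' := by
  have key : ∀ {c c' : ℕ × ℕ}, Mixed F x c → cellMax F x c = cellMax F x c' →
      c.1 + c.2 = c'.1 + c'.2 → ¬ c.1 < c'.1 := by
    intro c c' hc h1 h2 hlt
    have hx : 0 < 2 ^ x := by positivity
    have h3 : (c.1 + 1) * 2 ^ x ≤ c'.1 * 2 ^ x := Nat.mul_le_mul_right _ hlt
    have h4 : (c'.2 + 1) * 2 ^ x ≤ c.2 * 2 ^ x := Nat.mul_le_mul_right _ (by omega)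
    have : cellMax F x c' ≤ cellMin F x c := by
      refine hF.mono ?_ ?_
      · rw [add_mul] at h3; omega
      · rw [add_mul] at h4; omega
    unfold Mixed at hc
    omega
  have h3 := key hc h1 h2
  have h4 := key hc' h1.symm h2.symm
  ext <;> omega

end

/-! ### Levels -/

/-- The level `l` consists of cells of size `2 ^ x l`.  The level `0` has all cells of windows in
`[0, 2 ^ b)`, the level `l + 1` has the subcells of the cells of level `l` with several
frequencies.  The value is the number of cells and their enumeration. -/
noncomputable def level (F : ℕ → ℕ → ℕ) (b : ℕ) (x : ℕ → ℕ) : ℕ → ℕ × (ℕ → ℕ × ℕ)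
  | 0 => (2 ^ (b - x 0) * 2 ^ (b - x 0), subcell (b - x 0) (0, 0))
  | l + 1 =>
    (Nat.count (fun p => Mixed F (x l) ((level F b x l).2 p)) (level F b x l).1 *
      (2 ^ (x l - x (l + 1)) * 2 ^ (x l - x (l + 1))),
    fun p => subcell (x l - x (l + 1))
      ((level F b x l).2 (Nat.nth (fun p => Mixed F (x l) ((level F b x l).2 p))
        (p / 2 ^ (x l - x (l + 1)) / 2 ^ (x l - x (l + 1))))) p)

section

variable (F : ℕ → ℕ → ℕ) (b : ℕ) (x : ℕ → ℕ)

/-- The number of cells of a level. -/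
noncomputable def levelCard (l : ℕ) : ℕ := (level F b x l).1

/-- The cell number `p` of a level. -/
noncomputable def levelCell (l p : ℕ) : ℕ × ℕ := (level F b x l).2 p

/-- The number of mixed cells of a level among the first `p` cells. -/
noncomputable def mixedCount (l p : ℕ) : ℕ :=
  Nat.count (fun p => Mixed F (x l) (levelCell F b x l p)) p

/-- The mixed cell of level `l` that contains the cell number `p` of level `l + 1`. -/
noncomputable def parentIdx (l p : ℕ) : ℕ :=
  Nat.nth (fun p => Mixed F (x l) (levelCell F b x l p))
    (p / 2 ^ (x l - x (l + 1)) / 2 ^ (x l - x (l + 1)))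

theorem levelCard_zero : levelCard F b x 0 = 2 ^ (b - x 0) * 2 ^ (b - x 0) := rfl

theorem levelCard_succ (l : ℕ) : levelCard F b x (l + 1) =
    mixedCount F b x l (levelCard F b x l) *
      (2 ^ (x l - x (l + 1)) * 2 ^ (x l - x (l + 1))) := rfl

theorem levelCell_zero (p : ℕ) : levelCell F b x 0 p = subcell (b - x 0) (0, 0) p := rfl

theorem levelCell_succ (l p : ℕ) : levelCell F b x (l + 1) p =
    subcell (x l - x (l + 1)) (levelCell F b x l (parentIdx F b x l p)) p := rfl

variable {F b x} {l p : ℕ}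

theorem div_div_lt (h : p < levelCard F b x (l + 1)) :
    p / 2 ^ (x l - x (l + 1)) / 2 ^ (x l - x (l + 1)) <
      mixedCount F b x l (levelCard F b x l) := by
  rw [Nat.div_div_eq_div_mul, Nat.div_lt_iff_lt_mul (by positivity)]
  exact h

theorem parentIdx_lt (h : p < levelCard F b x (l + 1)) :
    parentIdx F b x l p < levelCard F b x l :=
  Nat.nth_lt_of_lt_count (div_div_lt h)

theorem mixedCount_parentIdx (h : p < levelCard F b x (l + 1)) :
    mixedCount F b x l (parentIdx F b x l p) =
      p / 2 ^ (x l - x (l + 1)) / 2 ^ (x l - x (l + 1)) := by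
  have h' := div_div_lt h
  apply Nat.count_nth (p := fun p => Mixed F (x l) (levelCell F b x l p))
  -- `Nat.count_nth` asks for an index bound only if finitely many numbers in all of `ℕ` qualify;
  -- those below `levelCard` already suffice.
  intro hf
  refine lt_of_lt_of_le h' ?_
  rw [mixedCount, Nat.count_eq_card_filter_range]
  exact Finset.card_le_card fun y hy => by simpa using (Finset.mem_filter.1 hy).2

theorem subcell_lt {g k u : ℕ} {c : ℕ × ℕ} (h : c.1 < 2 ^ k ∧ c.2 < 2 ^ k) (p : ℕ)
    (hu : u = k + g) : (subcell g c p).1 < 2 ^ u ∧ (subcell g c p).2 < 2 ^ u := by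
  have hg : 0 < 2 ^ g := by positivity
  have key : ∀ i r, i < 2 ^ k → r < 2 ^ g → i * 2 ^ g + r < 2 ^ u := by
    intro i r hi hr
    rw [hu, pow_add]
    have : (i + 1) * 2 ^ g ≤ 2 ^ k * 2 ^ g := Nat.mul_le_mul_right _ hi
    rw [add_mul] at this
    omega
  exact ⟨key _ _ h.1 (Nat.mod_lt _ hg), key _ _ h.2 (Nat.mod_lt _ hg)⟩

theorem levelCell_lt (hx : Antitone x) (hb : x 0 ≤ b) (h : p < levelCard F b x l) :
    (levelCell F b x l p).1 < 2 ^ (b - x l) ∧ (levelCell F b x l p).2 < 2 ^ (b - x l) := by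
  induction l generalizing p with
  | zero =>
    rw [levelCell_zero]
    exact subcell_lt (k := 0) (by simp) p (by omega)
  | succ l ih =>
    rw [levelCell_succ]
    have h1 := hx (Nat.le_succ l)
    have h2 := hx (Nat.zero_le l)
    simp only [Nat.succ_eq_add_one] at h1
    exact subcell_lt (ih (parentIdx_lt h)) p (by omega)

theorem subcell_eq {g p p' : ℕ} {c c' : ℕ × ℕ} (h : subcell g c p = subcell g c' p') :
    c = c' ∧ p / 2 ^ g % 2 ^ g = p' / 2 ^ g % 2 ^ g ∧ p % 2 ^ g = p' % 2 ^ g := by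
  have hg : 0 < 2 ^ g := by positivity
  have key : ∀ {i j u v : ℕ}, u < 2 ^ g → v < 2 ^ g → i * 2 ^ g + u = j * 2 ^ g + v →
      i = j ∧ u = v := by
    intro i j u v hu hv h
    have h1 : u = v := by
      have := congrArg (· % 2 ^ g) h
      simpa [mul_add_mod_self hu, mul_add_mod_self hv] using this
    subst h1
    exact ⟨Nat.eq_of_mul_eq_mul_right hg (by omega), rfl⟩
  unfold subcell at h
  obtain ⟨h1, h2⟩ := Prod.mk.inj h
  obtain ⟨h3, h4⟩ := key (Nat.mod_lt _ hg) (Nat.mod_lt _ hg) h1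
  obtain ⟨h5, h6⟩ := key (Nat.mod_lt _ hg) (Nat.mod_lt _ hg) h2
  exact ⟨Prod.ext h3 h5, h4, h6⟩

/-- A subcell determines its parent and its offsets, the parent determines its number by induction,
and these data make up the number. Thus counting numbers is counting cells. -/
theorem levelCell_inj {p' : ℕ} (h : p < levelCard F b x l) (h' : p' < levelCard F b x l)
    (heq : levelCell F b x l p = levelCell F b x l p') : p = p' := by
  induction l generalizing p p' with
  | zero =>
    rw [levelCard_zero] at h h'
    obtain ⟨-, h1, h2⟩ := subcell_eq heq
    rw [Nat.mod_eq_of_lt (Nat.div_lt_of_lt_mul h), Nat.mod_eq_of_lt (Nat.div_lt_of_lt_mul h')]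
      at h1
    rw [← Nat.div_add_mod p (2 ^ (b - x 0)), ← Nat.div_add_mod p' (2 ^ (b - x 0)), h1, h2]
  | succ l ih =>
    obtain ⟨h1, h2, h3⟩ := subcell_eq heq
    have h4 := congrArg (mixedCount F b x l) (ih (parentIdx_lt h) (parentIdx_lt h') h1)
    rw [mixedCount_parentIdx h, mixedCount_parentIdx h'] at h4
    set G := 2 ^ (x l - x (l + 1))
    rw [← Nat.div_add_mod p G, ← Nat.div_add_mod p' G, ← Nat.div_add_mod (p / G) G,
      ← Nat.div_add_mod (p' / G) G, h2, h3, h4]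

theorem mixedCount_le {m : ℕ} (hF : WindowFreq F m) (hx : Antitone x) (hb : x 0 ≤ b) :
    mixedCount F b x l (levelCard F b x l) ≤ m * (2 * 2 ^ (b - x l)) := by
  rw [mixedCount, Nat.count_eq_card_filter_range]
  have := Finset.card_le_card_of_injOn (t := Finset.range m ×ˢ Finset.range (2 * 2 ^ (b - x l)))
    (s := {p ∈ Finset.range (levelCard F b x l) | Mixed F (x l) (levelCell F b x l p)})
    -- A mixed cell has a positive maximum, so subtracting one leaves `m` values; the sum of the
    -- coordinates has fewer than `2 * 2 ^ (b - x l)`.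
    (fun p => (cellMax F (x l) (levelCell F b x l p) - 1,
      (levelCell F b x l p).1 + (levelCell F b x l p).2)) ?_ ?_
  · simpa using this
  · intro p hp
    simp only [Finset.coe_filter, Finset.mem_range, Set.mem_ofPred_eq] at hp
    obtain ⟨hp, hm⟩ := hp
    have h1 := levelCell_lt hx hb hp
    have h2 : cellMax F (x l) (levelCell F b x l p) ≤ m := hF.le _ _
    unfold Mixed at hm
    simp only [Finset.coe_product, Finset.coe_range, Set.mem_prod, Set.mem_Iio]
    omega
  · intro p hp p' hp' heq
    simp only [Finset.coe_filter, Finset.mem_range, Set.mem_ofPred_eq] at hp hp'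
    obtain ⟨h1, h2⟩ := Prod.mk.inj heq
    refine levelCell_inj hp.1 hp'.1 (hF.mixed_injOn (x l) hp.2 hp'.2 ?_ h2)
    have := hp.2
    have := hp'.2
    unfold Mixed at *
    omega

/-- The number of the subcell of the mixed cell `p` of level `l` that contains `(a, e)`. -/
noncomputable def childIdx (F : ℕ → ℕ → ℕ) (b : ℕ) (x : ℕ → ℕ) (l p a e : ℕ) : ℕ :=
  (mixedCount F b x l p * 2 ^ (x l - x (l + 1)) + a / 2 ^ x (l + 1) % 2 ^ (x l - x (l + 1))) *
    2 ^ (x l - x (l + 1)) + e / 2 ^ x (l + 1) % 2 ^ (x l - x (l + 1))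

theorem childIdx_lt (a e : ℕ) (hp : p < levelCard F b x l)
    (hm : Mixed F (x l) (levelCell F b x l p)) :
    childIdx F b x l p a e < levelCard F b x (l + 1) := by
  rw [levelCard_succ, childIdx]
  have h1 : mixedCount F b x l p < mixedCount F b x l (levelCard F b x l) :=
    Nat.count_strict_mono hm hp
  set g := x l - x (l + 1)
  have hg : 0 < 2 ^ g := by positivity
  have h2 := Nat.mod_lt (a / 2 ^ x (l + 1)) hg
  have h3 := Nat.mod_lt (e / 2 ^ x (l + 1)) hg
  set u := a / 2 ^ x (l + 1) % 2 ^ g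
  set v := e / 2 ^ x (l + 1) % 2 ^ g
  set i := mixedCount F b x l p
  have h4 : (i + 1) * 2 ^ g ≤ mixedCount F b x l (levelCard F b x l) * 2 ^ g :=
    Nat.mul_le_mul_right _ h1
  have h5 : (i * 2 ^ g + u + 1) * 2 ^ g ≤ mixedCount F b x l (levelCard F b x l) * 2 ^ g * 2 ^ g :=
    Nat.mul_le_mul_right _ (by rw [add_mul] at h4; omega)
  rw [← mul_assoc]
  have h6 : (i * 2 ^ g + u + 1) * 2 ^ g = (i * 2 ^ g + u) * 2 ^ g + 2 ^ g := by ring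
  omega

theorem parentIdx_childIdx (a e : ℕ)
    (hm : Mixed F (x l) (levelCell F b x l p)) :
    parentIdx F b x l (childIdx F b x l p a e) = p := by
  rw [parentIdx, childIdx]
  have hg : 0 < 2 ^ (x l - x (l + 1)) := by positivity
  rw [add_comm (_ * _), Nat.add_mul_div_right _ _ hg, Nat.div_eq_of_lt (Nat.mod_lt _ hg), zero_add,
    add_comm (_ * _), Nat.add_mul_div_right _ _ hg, Nat.div_eq_of_lt (Nat.mod_lt _ hg), zero_add]
  exact Nat.nth_count (p := fun p => Mixed F (x l) (levelCell F b x l p)) hm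

/-- The invariant of the descent: coordinates of cells are never stored, since the number of the
child follows from a rank and from binary digits of `a` and `e`. -/
theorem levelCell_childIdx (hx : Antitone x) {a e : ℕ}
    (hc : levelCell F b x l p = cellOf (x l) a e) (hm : Mixed F (x l) (levelCell F b x l p)) :
    levelCell F b x (l + 1) (childIdx F b x l p a e) = cellOf (x (l + 1)) a e := by
  have hg : 0 < 2 ^ (x l - x (l + 1)) := by positivity
  have hle : x (l + 1) ≤ x l := hx (Nat.le_succ l)
  rw [levelCell_succ, parentIdx_childIdx a e hm, hc, childIdx,
    subcell_mk (Nat.mod_lt _ hg) (Nat.mod_lt _ hg)]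
  simp only [cellOf, div_two_pow_split hle]

/-- The number of the cell of level `0` that contains `(a, e)`. -/
def rootIdx (b : ℕ) (x : ℕ → ℕ) (a e : ℕ) : ℕ := a / 2 ^ x 0 * 2 ^ (b - x 0) + e / 2 ^ x 0

theorem div_two_pow_lt {x a : ℕ} (hb : x ≤ b) (ha : a < 2 ^ b) : a / 2 ^ x < 2 ^ (b - x) := by
  rw [Nat.div_lt_iff_lt_mul (by positivity), ← pow_add]
  rwa [Nat.sub_add_cancel hb]

theorem rootIdx_lt (hb : x 0 ≤ b) {a e : ℕ} (ha : a < 2 ^ b) (he : e < 2 ^ b) :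
    rootIdx b x a e < levelCard F b x 0 := by
  have h1 := div_two_pow_lt hb ha
  have h2 := div_two_pow_lt hb he
  have h3 : (a / 2 ^ x 0 + 1) * 2 ^ (b - x 0) ≤ 2 ^ (b - x 0) * 2 ^ (b - x 0) :=
    Nat.mul_le_mul_right _ h1
  rw [levelCard_zero, rootIdx]
  rw [add_mul] at h3
  omega

theorem levelCell_rootIdx (hb : x 0 ≤ b) {a e : ℕ} (ha : a < 2 ^ b) (he : e < 2 ^ b) :
    levelCell F b x 0 (rootIdx b x a e) = cellOf (x 0) a e := by
  have h1 := div_two_pow_lt hb ha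
  have h2 := div_two_pow_lt hb he
  have := subcell_mk (c := 0) (p := (0, 0)) h1 h2
  rw [levelCell_zero, rootIdx]
  simpa [cellOf] using this

end

/-! ### The index -/

/-- The data from which the index is built: the frequencies of windows, the side of a minimal
window on which a mode is found, the largest frequency, the number of bits of a position, and the
logarithms of the sizes of cells of the `L` levels. -/
structure Scheme where
  F : ℕ → ℕ → ℕ
  side : ℕ → ℕ → Bool
  m : ℕ
  b : ℕ
  x : ℕ → ℕ
  L : ℕ

/-- The number of ones among the first `p` bits. -/
def rank (z : ℕ → Bool) (p : ℕ) : ℕ := Nat.count (fun i => z i = true) p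

theorem rank_add (z : ℕ → Bool) (p k : ℕ) :
    rank z (p + k) = rank z p + Nat.count (fun i => z (p + i) = true) k :=
  Nat.count_add _ p k

theorem rank_le (z : ℕ → Bool) (p : ℕ) : rank z p ≤ p := Nat.count_le _

theorem count_congr {p q : ℕ → Prop} [DecidablePred p] [DecidablePred q] {N : ℕ}
    (h : ∀ i < N, p i ↔ q i) : Nat.count p N = Nat.count q N := by
  rw [Nat.count_eq_card_filter_range, Nat.count_eq_card_filter_range]
  congr 1
  exact Finset.filter_congr fun i hi => h i (Finset.mem_range.1 hi)

/-- The number of ones among the lowest `N` binary digits. -/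
def popcount (N v : ℕ) : ℕ := Nat.count (fun j => v.testBit j = true) N

/-- The directory gives the rank at the start of the block. The rest of the block is read as a
number with zeros on top, so a single table for full blocks also serves partial ones. -/
theorem rank_eq_add_popcount (z : ℕ → Bool) {N : ℕ} (hN : 0 < N) (p : ℕ) :
    rank z p = rank z (p / N * N) + popcount N (bitsNat z (p / N * N) (p % N)) := by
  have h1 := rank_add z (p / N * N) (p % N)
  rw [Nat.div_add_mod'] at h1
  rw [h1, popcount]
  congr 1
  have h2 : N = p % N + (N - p % N) := by have := Nat.mod_lt p hN; omega
  rw [show ∀ q : ℕ → Prop, ∀ _ : DecidablePred q, Nat.count q N =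
    Nat.count q (p % N + (N - p % N)) from fun q _ => by rw [← h2], Nat.count_add, count_congr (q := fun j =>
    (bitsNat z (p / N * N) (p % N)).testBit j = true) (N := p % N)]
  · rw [left_eq_add, Nat.count_eq_card_filter_range, Finset.card_eq_zero,
      Finset.filter_eq_empty_iff]
    intro i _
    simp [testBit_bitsNat]
  · intro i hi
    simp [testBit_bitsNat, hi]

/-! ### Bits of concatenated lists. -/

theorem bitAt_append_left {l l' : List Bool} {p : ℕ} (h : p < l.length) :
    bitAt (l ++ l') p = bitAt l p := List.getD_append _ _ _ _ h

theorem bitAt_append_right (l l' : List Bool) (p : ℕ) :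
    bitAt (l ++ l') (l.length + p) = bitAt l' p := by
  unfold bitAt
  rw [List.getD_append_right _ _ _ _ (by omega), Nat.add_sub_cancel_left]

theorem bitAt_map_range {N p : ℕ} (g : ℕ → Bool) (h : p < N) :
    bitAt ((List.range N).map g) p = g p := by
  unfold bitAt
  rw [List.getD_eq_getElem _ _ (by simpa using h)]
  simp

theorem length_flatMap_range (g : ℕ → List Bool) (N : ℕ) :
    ((List.range N).flatMap g).length = ∑ i ∈ Finset.range N, (g i).length := by
  induction N with
  | zero => simp
  | succ N ih => rw [List.range_succ, Finset.sum_range_succ, ← ih]; simp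

theorem bitAt_flatMap_range (g : ℕ → List Bool) {N l p : ℕ} (hl : l < N)
    (hp : p < (g l).length) :
    bitAt ((List.range N).flatMap g) (∑ i ∈ Finset.range l, (g i).length + p) =
      bitAt (g l) p := by
  induction N with
  | zero => omega
  | succ N ih =>
    rw [List.range_succ, List.flatMap_append]
    rcases Nat.lt_succ_iff_lt_or_eq.1 hl with h | rfl
    · rw [bitAt_append_left, ih h]
      rw [length_flatMap_range]
      calc _ < ∑ i ∈ Finset.range (l + 1), (g i).length := by
            rw [Finset.sum_range_succ]; omega
        _ ≤ _ := Finset.sum_le_sum_of_subset (Finset.range_mono h)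
    · rw [← length_flatMap_range, bitAt_append_right]
      simp

theorem pair_lt {M N i e : ℕ} (hi : i < M) (he : e < N) : i * N + e < M * N := by
  have : (i + 1) * N ≤ M * N := Nat.mul_le_mul_right _ hi
  rw [add_mul] at this
  omega

theorem pair_div {N i e : ℕ} (he : e < N) : (i * N + e) / N = i := by
  rw [add_comm, Nat.add_mul_div_right _ _ (by omega), Nat.div_eq_of_lt he, zero_add]

namespace Scheme

open Classical in
/-- Increments of the frequencies of the windows that start at a multiple of the size of the cells
of level `0`. -/
noncomputable def rowBits (I : Scheme) : List Bool :=
  (List.range (2 ^ (I.b - I.x 0) * 2 ^ I.b)).map fun p =>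
    decide (I.F (p / 2 ^ I.b * 2 ^ I.x 0) (p % 2 ^ I.b) <
      I.F (p / 2 ^ I.b * 2 ^ I.x 0) (p % 2 ^ I.b + 1))

/-- The increments of the curve of frequency `f`. -/
def curveBit (I : Scheme) (f d : ℕ) : Bool :=
  decide (f ≤ I.F (curve I.F f d) (d + 1 - curve I.F f d))

/-- Bits for all frequencies and all values of `a + e`. -/
def diagBits (I : Scheme) (g : ℕ → ℕ → Bool) : List Bool :=
  (List.range (I.m * 2 ^ (I.b + 1))).map fun p => g (p / 2 ^ (I.b + 1) + 1) (p % 2 ^ (I.b + 1))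

variable (I : Scheme)

/-- The number of cells of level `l`. -/
noncomputable abbrev card (l : ℕ) : ℕ := levelCard I.F I.b I.x l

/-- The cell number `p` of level `l`. -/
noncomputable abbrev cell (l p : ℕ) : ℕ × ℕ := levelCell I.F I.b I.x l p

/-- The difference of the largest frequencies in the parent of a cell and in the cell. -/
noncomputable def delta : ℕ → ℕ → ℕ
  | 0, _ => 0
  | l + 1, p => cellMax I.F (I.x l) (I.cell l (parentIdx I.F I.b I.x l p)) -
      cellMax I.F (I.x (l + 1)) (I.cell (l + 1) p)

/-- The number of bits of a difference. -/
def width (l : ℕ) : ℕ := I.x (l - 1) + 1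

/-- Which cells of a level are mixed. -/
noncomputable def flagBits (l : ℕ) : List Bool :=
  (List.range (I.card l)).map fun p => decide (Mixed I.F (I.x l) (I.cell l p))

/-- The differences of a level. -/
noncomputable def deltaBits (l : ℕ) : List Bool :=
  (List.range (I.card l * I.width l)).map fun p =>
    (I.delta l (p / I.width l)).testBit (p % I.width l)

/-- The bits stored for a level. -/
noncomputable def levelBits (l : ℕ) : List Bool := I.flagBits l ++ I.deltaBits l

/-- The part of the index that supports rank queries. -/
noncomputable def payload : List Bool :=
  I.rowBits ++ (I.diagBits I.curveBit ++ (I.diagBits I.side ++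
    (List.range I.L).flatMap I.levelBits))

/-- The bits of the payload. -/
noncomputable abbrev zbit (p : ℕ) : Bool := bitAt I.payload p

/-- The position of the curves in the payload. -/
noncomputable def curveOff : ℕ := I.rowBits.length

/-- The position of the sides in the payload. -/
noncomputable def sideOff : ℕ := I.curveOff + (I.diagBits I.curveBit).length

/-- The position of a level in the payload. -/
noncomputable def flagOff (l : ℕ) : ℕ :=
  I.sideOff + (I.diagBits I.side).length + ∑ i ∈ Finset.range l, (I.levelBits i).length

/-- The position of the differences of a level in the payload. -/
noncomputable def deltaOff (l : ℕ) : ℕ := I.flagOff l + I.card l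

/-! ### Lengths and contents of the parts of the payload. -/

theorem length_rowBits : I.rowBits.length = 2 ^ (I.b - I.x 0) * 2 ^ I.b := by simp [rowBits]

theorem length_diagBits (g : ℕ → ℕ → Bool) :
    (I.diagBits g).length = I.m * 2 ^ (I.b + 1) := by simp [diagBits]

theorem length_flagBits (l : ℕ) : (I.flagBits l).length = I.card l := by simp [flagBits]

theorem length_levelBits (l : ℕ) :
    (I.levelBits l).length = I.card l + I.card l * I.width l := by
  simp [levelBits, flagBits, deltaBits]

theorem length_payload : I.payload.length = 2 ^ (I.b - I.x 0) * 2 ^ I.b +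
    2 * (I.m * 2 ^ (I.b + 1)) +
    ∑ l ∈ Finset.range I.L, (I.card l + I.card l * I.width l) := by
  simp only [payload, List.length_append, length_rowBits, length_diagBits, length_flatMap_range,
    length_levelBits]
  ring

theorem zbit_row {i e : ℕ} (hi : i < 2 ^ (I.b - I.x 0)) (he : e < 2 ^ I.b) :
    I.zbit (i * 2 ^ I.b + e) = decide (I.F (i * 2 ^ I.x 0) e < I.F (i * 2 ^ I.x 0) (e + 1)) := by
  have h := pair_lt hi he
  rw [zbit, payload, bitAt_append_left (by rwa [length_rowBits]), rowBits, bitAt_map_range _ h,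
    pair_div he, mul_add_mod_self he]

theorem bitAt_diagBits (g : ℕ → ℕ → Bool) {f d : ℕ} (hf : f < I.m) (hd : d < 2 ^ (I.b + 1)) :
    bitAt (I.diagBits g) (f * 2 ^ (I.b + 1) + d) = g (f + 1) d := by
  rw [diagBits, bitAt_map_range _ (pair_lt hf hd), pair_div hd, mul_add_mod_self hd]

theorem zbit_curve {f d : ℕ} (hf : f < I.m) (hd : d < 2 ^ (I.b + 1)) :
    I.zbit (I.curveOff + (f * 2 ^ (I.b + 1) + d)) = I.curveBit (f + 1) d := by
  rw [zbit, payload, curveOff, bitAt_append_right,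
    bitAt_append_left (by rw [length_diagBits]; exact pair_lt hf hd), bitAt_diagBits I _ hf hd]

theorem zbit_side {f d : ℕ} (hf : f < I.m) (hd : d < 2 ^ (I.b + 1)) :
    I.zbit (I.sideOff + (f * 2 ^ (I.b + 1) + d)) = I.side (f + 1) d := by
  rw [zbit, payload, sideOff, curveOff, add_assoc, bitAt_append_right, bitAt_append_right,
    bitAt_append_left (by rw [length_diagBits]; exact pair_lt hf hd), bitAt_diagBits I _ hf hd]

theorem zbit_level {l p : ℕ} (hl : l < I.L) (hp : p < (I.levelBits l).length) :
    I.zbit (I.flagOff l + p) = bitAt (I.levelBits l) p := by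
  rw [zbit, payload, flagOff, sideOff, curveOff, add_assoc, add_assoc, add_assoc,
    bitAt_append_right, bitAt_append_right, bitAt_append_right,
    bitAt_flatMap_range _ hl hp]

theorem zbit_flag {l p : ℕ} (hl : l < I.L) (hp : p < I.card l) :
    I.zbit (I.flagOff l + p) = decide (Mixed I.F (I.x l) (I.cell l p)) := by
  rw [zbit_level I hl (by rw [length_levelBits]; omega), levelBits,
    bitAt_append_left (by rwa [length_flagBits]), flagBits, bitAt_map_range _ hp]

theorem zbit_delta {l p j : ℕ} (hl : l < I.L) (hp : p < I.card l) (hj : j < I.width l) :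
    I.zbit (I.deltaOff l + p * I.width l + j) = (I.delta l p).testBit j := by
  have h := pair_lt hp hj
  rw [deltaOff, add_assoc, add_assoc, zbit_level I hl (by rw [length_levelBits]; omega), levelBits,
    ← length_flagBits, bitAt_append_right, deltaBits, bitAt_map_range _ h,
    pair_div hj, mul_add_mod_self hj]

theorem bitsNat_delta {l p : ℕ} (hl : l < I.L) (hp : p < I.card l)
    (hd : I.delta l p < 2 ^ I.width l) :
    bitsNat I.zbit (I.deltaOff l + p * I.width l) (I.width l) = I.delta l p :=
  bitsNat_eq hd fun _ hj => I.zbit_delta hl hp hj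

/-- One rank structure serves the whole payload; the rank at the start of a segment is subtracted to
count inside it. -/
theorem rank_row {m : ℕ} (hF : WindowFreq I.F m) {i e : ℕ} (hi : i < 2 ^ (I.b - I.x 0))
    (he : e < 2 ^ I.b) :
    rank I.zbit (i * 2 ^ I.b + e) - rank I.zbit (i * 2 ^ I.b) = I.F (i * 2 ^ I.x 0) e := by
  rw [rank_add, Nat.add_sub_cancel_left, ← hF.count_steps]
  refine count_congr fun j hj => ?_
  rw [zbit_row I hi (hj.trans he), decide_eq_true_eq]

theorem rank_curve {f d : ℕ} (hf : f < I.m) (hd : d < 2 ^ (I.b + 1)) :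
    rank I.zbit (I.curveOff + f * 2 ^ (I.b + 1) + d) -
      rank I.zbit (I.curveOff + f * 2 ^ (I.b + 1)) = curve I.F (f + 1) d := by
  rw [rank_add, Nat.add_sub_cancel_left, curve_eq_count]
  refine count_congr fun j hj => ?_
  rw [add_assoc, zbit_curve I hf (hj.trans hd), curveBit, decide_eq_true_eq]

theorem rank_flag {l p : ℕ} (hl : l < I.L) (hp : p ≤ I.card l) :
    rank I.zbit (I.flagOff l + p) - rank I.zbit (I.flagOff l) = mixedCount I.F I.b I.x l p := by
  rw [rank_add, Nat.add_sub_cancel_left, mixedCount]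
  refine count_congr fun j hj => ?_
  rw [zbit_flag I hl (by omega), decide_eq_true_eq]

theorem flagOff_add_le {l p : ℕ} (hl : l < I.L) (hp : p ≤ (I.levelBits l).length) :
    I.flagOff l + p ≤ I.payload.length := by
  have : ∑ i ∈ Finset.range (l + 1), (I.levelBits i).length ≤
      ∑ i ∈ Finset.range I.L, (I.levelBits i).length :=
    Finset.sum_le_sum_of_subset (Finset.range_mono hl)
  rw [Finset.sum_range_succ] at this
  simp only [payload, List.length_append, length_flatMap_range, flagOff, sideOff, curveOff]
  omega

/-- The conditions under which the index works. -/
structure Valid : Prop where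
  freq : WindowFreq I.F I.m
  anti : Antitone I.x
  x_le : I.x 0 ≤ I.b
  b_pos : 0 < I.b
  L_le : I.L ≤ I.b + 2
  last : ∃ l < I.L, I.x l = 0
  length_le : I.payload.length ≤ 2 ^ (20 * I.b)

/-- The number of bits of a block of the rank directory. -/
def block : ℕ := (I.b + 1) / 2

/-- The first field of the table of population counts. -/
def tbl : ℕ := 6 + 3 * I.L

/-- The first field of the rank directory. -/
def dir : ℕ := I.tbl + 2 ^ I.block

/-- The number of fields. -/
noncomputable def numFields : ℕ := I.dir + I.payload.length / I.block + 1

/-- The fields of `32 * b` bits that precede the payload. -/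
noncomputable def field (i : ℕ) : ℕ :=
  if i = 0 then 2 ^ (I.b + 1) * I.b + 2 ^ I.b
  else if i = 1 then I.numFields * (32 * I.b)
  else if i = 2 then I.tbl
  else if i = 3 then I.dir
  else if i = 4 then I.curveOff
  else if i = 5 then I.sideOff
  else if i < I.tbl then
    if (i - 6) % 3 = 0 then I.x ((i - 6) / 3)
    else if (i - 6) % 3 = 1 then I.flagOff ((i - 6) / 3)
    else I.deltaOff ((i - 6) / 3)
  else if i < I.dir then popcount I.block (i - I.tbl)
  else rank I.zbit ((i - I.dir) * I.block)

/-- The index. -/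
noncomputable def index : List Bool :=
  (List.range (I.numFields * (32 * I.b))).map
    (fun p => (I.field (p / (32 * I.b))).testBit (p % (32 * I.b))) ++ I.payload

theorem length_index : I.index.length = I.numFields * (32 * I.b) + I.payload.length := by
  simp [index]

theorem field_x {l : ℕ} (hl : l < I.L) : I.field (6 + 3 * l) = I.x l := by
  have h1 : 6 + 3 * l < I.tbl := by unfold tbl; omega
  have h2 : (6 + 3 * l - 6) % 3 = 0 := by omega
  have h3 : (6 + 3 * l - 6) / 3 = l := by omega
  simp only [field, h1, h2, h3, if_true]
  repeat' rw [if_neg (by omega)]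

theorem field_flagOff {l : ℕ} (hl : l < I.L) : I.field (6 + 3 * l + 1) = I.flagOff l := by
  have h1 : 6 + 3 * l + 1 < I.tbl := by unfold tbl; omega
  have h2 : (6 + 3 * l + 1 - 6) % 3 = 1 := by omega
  have h3 : (6 + 3 * l + 1 - 6) / 3 = l := by omega
  simp only [field, h1, h2, h3, if_true]
  repeat' rw [if_neg (by omega)]

theorem field_deltaOff {l : ℕ} (hl : l < I.L) : I.field (6 + 3 * l + 2) = I.deltaOff l := by
  have h1 : 6 + 3 * l + 2 < I.tbl := by unfold tbl; omega
  have h2 : (6 + 3 * l + 2 - 6) % 3 = 2 := by omega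
  have h3 : (6 + 3 * l + 2 - 6) / 3 = l := by omega
  simp only [field, h1, h2, h3, if_true]
  repeat' rw [if_neg (by omega)]

theorem field_tbl {v : ℕ} (hv : v < 2 ^ I.block) : I.field (I.tbl + v) = popcount I.block v := by
  have h1 : I.tbl + v < I.dir := Nat.add_lt_add_left hv _
  have h3 : 6 ≤ I.tbl := by unfold tbl; omega
  simp only [field, h1, if_true, Nat.add_sub_cancel_left]
  repeat' rw [if_neg (by omega)]

theorem field_dir (q : ℕ) : I.field (I.dir + q) = rank I.zbit (q * I.block) := by
  have h2 : I.tbl ≤ I.dir := Nat.le_add_right _ _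
  have h3 : 6 ≤ I.tbl := by unfold tbl; omega
  simp only [field, Nat.add_sub_cancel_left]
  repeat' rw [if_neg (by omega)]

theorem bitsNat_payload (p len : ℕ) :
    bitsNat (bitAt I.index) (I.numFields * (32 * I.b) + p) len = bitsNat I.zbit p len := by
  refine bitsNat_congr fun j _ => ?_
  have := bitAt_append_right ((List.range (I.numFields * (32 * I.b))).map
    (fun p => (I.field (p / (32 * I.b))).testBit (p % (32 * I.b)))) I.payload (p + j)
  rw [List.length_map, List.length_range] at this
  rw [index, add_assoc, this]

/-! ### Bounds for the fields and decoding of the header. -/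

namespace Valid

variable {I} (hI : I.Valid)
include hI

theorem block_pos : 0 < I.block := by
  have := hI.b_pos
  unfold block
  omega

theorem two_le : 2 ≤ 2 ^ I.b := by
  have := Nat.pow_le_pow_right (show 0 < 2 by norm_num) hI.b_pos
  simpa using this

theorem numFields_le : I.numFields * (32 * I.b) ≤ 2 ^ (30 * I.b) := by
  have h2 := hI.two_le
  have hb : I.b ≤ 2 ^ I.b := Nat.lt_two_pow_self.le
  have hblock : I.block ≤ I.b := by have := hI.b_pos; unfold block; omega
  have h3 : 2 ^ I.block ≤ 2 ^ I.b := Nat.pow_le_pow_right (by norm_num) hblock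
  have h4 : I.payload.length / I.block ≤ 2 ^ (20 * I.b) := (Nat.div_le_self _ _).trans hI.length_le
  have h5 := hI.L_le
  have h0 : I.numFields ≤ 13 + 3 * I.b + 2 ^ I.b + 2 ^ (20 * I.b) := by
    unfold numFields dir tbl
    omega
  rw [mul_comm 30, pow_mul]
  rw [mul_comm 20, pow_mul] at h0
  set B := 2 ^ I.b
  have h6 : B ≤ B ^ 20 := Nat.le_self_pow (by norm_num) B
  have h7 : 2 ^ 4 ≤ B ^ 4 := Nat.pow_le_pow_left h2 4
  have h8 : 2 ^ 5 ≤ B ^ 5 := Nat.pow_le_pow_left h2 5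
  -- There are at most `16 * B ^ 20` fields, and `16 ≤ B ^ 4`, `32 ≤ B ^ 5`, `b ≤ B`.
  calc I.numFields * (32 * I.b) ≤ (B ^ 4 * B ^ 20) * (B ^ 5 * B) := by
        refine Nat.mul_le_mul ?_ (Nat.mul_le_mul h8 hb)
        have h9 : 2 ^ 4 * B ^ 20 ≤ B ^ 4 * B ^ 20 := Nat.mul_le_mul_right _ h7
        omega
    _ = B ^ 30 := by ring

theorem field_lt {i : ℕ} (hi : i < I.numFields) : I.field i < 2 ^ (32 * I.b) := by
  have h2 := hI.two_le
  have hb : I.b ≤ 2 ^ I.b := Nat.lt_two_pow_self.le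
  have hn := hI.numFields_le
  have hW : 0 < 32 * I.b := by have := hI.b_pos; omega
  have h30 : 2 ^ (30 * I.b) < 2 ^ (32 * I.b) :=
    Nat.pow_lt_pow_right (by norm_num) (by have := hI.b_pos; omega)
  have hfields : I.numFields ≤ 2 ^ (30 * I.b) := le_trans (Nat.le_mul_of_pos_right _ hW) hn
  have hz : I.payload.length ≤ 2 ^ (30 * I.b) := hI.length_le.trans
    (Nat.pow_le_pow_right (by norm_num) (by omega))
  have hpb : 2 ^ I.b ≤ 2 ^ (30 * I.b) := Nat.pow_le_pow_right (by norm_num) (by omega)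
  have hdir : I.dir ≤ I.numFields := (Nat.le_add_right _ _).trans (Nat.le_add_right _ 1)
  have htbl : I.tbl ≤ I.dir := Nat.le_add_right _ _
  refine lt_of_le_of_lt ?_ h30
  unfold field
  split_ifs with h0 h1 h2' h3 h4 h5 h6 h7 h8 h9
  · calc 2 ^ (I.b + 1) * I.b + 2 ^ I.b ≤ 2 ^ (I.b + 1) * 2 ^ I.b + 2 ^ (I.b + 1) * 2 ^ I.b := by
          refine Nat.add_le_add (Nat.mul_le_mul_left _ hb) (Nat.le_mul_of_pos_left _ (by positivity))
      _ = 2 ^ (2 * I.b + 2) := by ring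
      _ ≤ 2 ^ (30 * I.b) := Nat.pow_le_pow_right (by norm_num) (by have := hI.b_pos; omega)
  · exact hn
  · omega
  · omega
  · refine le_trans ?_ hz
    simp only [curveOff, payload, List.length_append]; omega
  · refine le_trans ?_ hz
    simp only [sideOff, curveOff, payload, List.length_append]; omega
  · have := hI.anti (Nat.zero_le ((i - 6) / 3))
    have := hI.x_le
    omega
  · refine le_trans ?_ hz
    exact I.flagOff_add_le (p := 0) (by unfold tbl at h6; omega) (Nat.zero_le _)
  · refine le_trans ?_ hz
    refine I.flagOff_add_le (by unfold tbl at h6; omega) ?_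
    rw [length_levelBits]; omega
  · refine le_trans (Nat.count_le _) ?_
    have : I.block ≤ I.b := by have := hI.b_pos; unfold block; omega
    omega
  · refine le_trans (rank_le _ _) (le_trans ?_ hz)
    have : i - I.dir ≤ I.payload.length / I.block := by
      unfold numFields at hi
      generalize I.payload.length / I.block = q at *
      omega
    exact (Nat.mul_le_mul_right _ this).trans (Nat.div_mul_le_self _ _)

theorem bitsNat_field {i : ℕ} (hi : i < I.numFields) :
    bitsNat (bitAt I.index) (i * (32 * I.b)) (32 * I.b) = I.field i := by
  refine bitsNat_eq (hI.field_lt hi) fun j hj => ?_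
  have h := pair_lt hi hj
  rw [index, bitAt_append_left (by simpa using h), bitAt_map_range _ h, pair_div hj,
    mul_add_mod_self hj]

theorem rank_eq {p : ℕ} : rank I.zbit p = I.field (I.dir + p / I.block) +
    I.field (I.tbl + bitsNat I.zbit (p / I.block * I.block) (p % I.block)) := by
  rw [I.field_dir, I.field_tbl, ← rank_eq_add_popcount _ hI.block_pos]
  exact (bitsNat_lt _ _ _).trans_le
    (Nat.pow_le_pow_right (by norm_num) (Nat.mod_lt _ hI.block_pos).le)

/-- Word 0 may reach beyond field 0 into unrelated bits. They start at position `32 * b`, too high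
to disturb `z` modulo `2 ^ (b + 1)`. -/
theorem decode_header {w : ℕ} (hw : 32 * I.b ≤ w) :
    ∃ z, bitsNat (bitAt I.index) 0 w = 2 ^ (I.b + 1) * z + 2 ^ I.b ∧ z % 2 ^ (I.b + 1) = I.b := by
  have h0 : bitsNat (bitAt I.index) 0 w % 2 ^ (32 * I.b) = 2 ^ (I.b + 1) * I.b + 2 ^ I.b := by
    have h1 : bitsNat (bitAt I.index) (0 * (32 * I.b)) (32 * I.b) = I.field 0 :=
      hI.bitsNat_field (Nat.succ_pos _)
    have h2 : I.field 0 = 2 ^ (I.b + 1) * I.b + 2 ^ I.b := by simp [field]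
    rw [← h2, ← h1]
    apply Nat.eq_of_testBit_eq
    intro j
    rw [Nat.testBit_mod_two_pow, testBit_bitsNat, testBit_bitsNat]
    by_cases hj : j < 32 * I.b
    · simp [hj, hj.trans_le hw]
    · simp [hj]
  have h1 := Nat.div_add_mod (bitsNat (bitAt I.index) 0 w) (2 ^ (32 * I.b))
  rw [h0] at h1
  have hb := hI.b_pos
  have h2 : 32 * I.b = (I.b + 1) + ((I.b + 1) + (30 * I.b - 2)) := by omega
  refine ⟨2 ^ (I.b + 1) * (2 ^ (30 * I.b - 2) *
    (bitsNat (bitAt I.index) 0 w / 2 ^ (32 * I.b))) + I.b, ?_, ?_⟩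
  · conv_lhs => rw [← h1]
    generalize bitsNat (bitAt I.index) 0 w / 2 ^ (32 * I.b) = q
    rw [h2, pow_add 2 (I.b + 1), pow_add 2 (I.b + 1)]
    ring
  · rw [Nat.mul_add_mod, Nat.mod_eq_of_lt]
    exact Nat.lt_two_pow_self.trans (Nat.pow_lt_pow_right (by norm_num) (by omega))

end Valid

end Scheme

/-- Subtracting one flips the lowest one and the zeros below it. In the header this one stands at
position `b`, so `2 ^ (b + 1)` is found in constant time without computing a logarithm. -/
theorem xor_pred (z k : ℕ) :
    (2 ^ (k + 1) * z + 2 ^ k) ^^^ (2 ^ (k + 1) * z + 2 ^ k - 1) = 2 ^ (k + 1) - 1 := by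
  have hk : 0 < 2 ^ k := by positivity
  have h1 : 2 ^ k < 2 ^ (k + 1) := Nat.pow_lt_pow_right (by norm_num) (by omega)
  have h2 : 2 ^ (k + 1) * z + 2 ^ k - 1 = 2 ^ (k + 1) * z + (2 ^ k - 1) := by omega
  apply Nat.eq_of_testBit_eq
  intro j
  rw [h2, Nat.testBit_xor, Nat.testBit_two_pow_mul_add _ h1,
    Nat.testBit_two_pow_mul_add _ (by omega), Nat.testBit_two_pow_sub_one]
  by_cases hj : j < k + 1
  · simp only [hj, if_true, Nat.testBit_two_pow, Nat.testBit_two_pow_sub_one]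
    by_cases hk : k = j
    · simp [hk]
    · simp [hk]; omega
  · simp [hj]

/-! ### The query program

Registers: `0` start of the window, `3` word size, `4` bits of a position, `5` end of the window,
`6` position of the payload, `7` field of the table, `8` field of the directory, `9` logarithm of
the size of the cell, `10` position of the flags of the level, `11` largest frequency in the cell,
`12` number of the cell, `13` first field of the level. -/

/-- The number of bits of a field. -/
def fieldWidthExpr : Expr := .op .mul (.const 32) (.reg 4)

/-- A field of the index. -/
def fieldExpr (i : Expr) : Expr := bitsExpr (.op .mul i fieldWidthExpr) fieldWidthExpr

/-- Bits of the payload. -/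
def payloadExpr (p len : Expr) : Expr := bitsExpr (.op .add (.reg 6) p) len

/-- The length of a block of the rank directory. -/
def blockExpr : Expr := .op .div (.op .add (.reg 4) (.const 1)) (.const 2)

/-- The number of ones among the first bits of the payload. -/
def rankExpr (p : Expr) : Expr :=
  .op .add (fieldExpr (.op .add (.reg 8) (.op .div p blockExpr)))
    (fieldExpr (.op .add (.reg 7)
      (payloadExpr (.op .mul (.op .div p blockExpr) blockExpr) (.op .mod p blockExpr))))

/-- The number of ones among `k` bits of the payload that start at `p`. -/
def countExpr (p k : Expr) : Expr := .op .sub (rankExpr (.op .add p k)) (rankExpr p)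

/-- The power of two above the one in the header of the index. -/
def headerExpr : Expr :=
  .op .add (.op .xor (.readIdx (.const 0)) (.op .sub (.readIdx (.const 0)) (.const 1))) (.const 1)

/-- The block of size `2 ^ x` that contains a position. -/
def cellExpr (pos x : Expr) : Expr := .op .div pos (.op .shl (.const 1) x)

/-- The number of subcells of a cell in a row. -/
def splitExpr : Expr := .op .shl (.const 1) (.op .sub (.reg 9) (.reg 15))

/-- The assignments that find the cell of level `0`. -/
def rootAssigns : List (ℕ × Expr) :=
  [(11, countExpr (.op .mul (cellExpr (.reg 0) (.reg 9)) (.op .shl (.const 1) (.reg 4)))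
      (.op .add (.op .mul (cellExpr (.reg 5) (.reg 9)) (.op .shl (.const 1) (.reg 9)))
        (.op .sub (.op .shl (.const 1) (.reg 9)) (.const 1)))),
   (12, .op .add (.op .mul (cellExpr (.reg 0) (.reg 9))
      (.op .shl (.const 1) (.op .sub (.reg 4) (.reg 9)))) (cellExpr (.reg 5) (.reg 9)))]

/-- The assignments before the search for the frequency. -/
def initAssigns : List (ℕ × Expr) :=
  (4, .op .mod (.op .div (.readIdx (.const 0)) headerExpr) headerExpr) ::
  (5, .op .add (.reg 1) (.const 1)) ::
  (6, fieldExpr (.const 1)) ::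
  (7, fieldExpr (.const 2)) ::
  (8, fieldExpr (.const 3)) ::
  (9, fieldExpr (.const 6)) ::
  (10, fieldExpr (.const 7)) ::
  (13, .const 6) :: rootAssigns

/-- Whether the current cell is mixed. -/
def mixedExpr : Expr := payloadExpr (.op .add (.reg 10) (.reg 12)) (.const 1)

/-- One step of the search for the frequency. -/
def stepAssigns : List (ℕ × Expr) :=
  [(14, countExpr (.reg 10) (.reg 12)),
   (13, .op .add (.reg 13) (.const 3)),
   (15, fieldExpr (.reg 13)),
   (12, .op .add (.op .mul (.op .add (.op .mul (.reg 14) splitExpr)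
      (.op .mod (cellExpr (.reg 0) (.reg 15)) splitExpr)) splitExpr)
      (.op .mod (cellExpr (.reg 5) (.reg 15)) splitExpr)),
   (11, .op .sub (.reg 11)
      (payloadExpr (.op .add (fieldExpr (.op .add (.reg 13) (.const 2)))
        (.op .mul (.reg 12) (.op .add (.reg 9) (.const 1)))) (.op .add (.reg 9) (.const 1)))),
   (9, .reg 15),
   (10, fieldExpr (.op .add (.reg 13) (.const 1)))]

/-- The position of the bits of the frequency that was found, relative to all frequencies. -/
def diagExpr : Expr :=
  .op .mul (.op .sub (.reg 11) (.const 1)) (.op .shl (.const 1) (.op .add (.reg 4) (.const 1)))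

/-- The assignments after the search for the frequency. -/
def finalAssigns : List (ℕ × Expr) :=
  [(14, .op .add (.reg 0) (.reg 5)),
   (15, countExpr (.op .add (fieldExpr (.const 4)) diagExpr) (.reg 14)),
   (16, payloadExpr (.op .add (fieldExpr (.const 5)) (.op .add diagExpr (.reg 14))) (.const 1))]

/-- The answer. -/
def answerProgram : Program :=
  .cond (.reg 16) (.set 0 (.readStr (.op .sub (.reg 15) (.const 1))))
    (.set 0 (.readStr (.op .sub (.reg 14) (.reg 15))))

/-- The program that answers range mode queries. -/
def queryProgram : Program :=
  .seq (assigns initAssigns) (.seq (.loop mixedExpr (assigns stepAssigns))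
    (.seq (assigns finalAssigns) answerProgram))

/-! ### Correctness and running time of the query program. -/

section

variable {w n σ : ℕ} {S : Fin n → Fin σ} {D : List Bool} {ρ : ℕ → ℕ} {e e' : Expr} {u v : ℕ}

theorem Evals.readStr (h : Evals (w := w) S D ρ e v) :
    Evals (w := w) S D ρ (.readStr e) (strWord w S v).toNat := by
  intro s hs
  simp [Expr.eval, h s hs]

theorem Evals.cell (h : Evals (w := w) S D ρ e u) (h' : Evals (w := w) S D ρ e' v)
    (hv : v < w) : Evals (w := w) S D ρ (cellExpr e e') (u / 2 ^ v) := by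
  have hw : 2 ^ 0 < 2 ^ w := Nat.pow_lt_pow_right (by norm_num) (by omega)
  have h1 : Evals (w := w) S D ρ (.const 1) 1 := evals_const 1 (by simpa using hw)
  have h2 := h.div (h1.shl h' (by rw [one_mul]; exact Nat.pow_lt_pow_right (by norm_num) hv))
  exact h2.cast (by rw [one_mul])

theorem exists_assigns_cons {x : ℕ} {l : List (ℕ × Expr)} {Q : (ℕ → ℕ) → Prop}
    (h : Evals (w := w) S D ρ e v)
    (h' : ∃ ρ', Runs w S D (assigns l) (Function.update ρ x v) (assignsCost l) ρ' ∧ Q ρ') :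
    ∃ ρ', Runs w S D (assigns ((x, e) :: l)) ρ (assignsCost ((x, e) :: l)) ρ' ∧ Q ρ' := by
  obtain ⟨ρ', h1, h2⟩ := h'
  exact ⟨ρ', Runs.assigns_cons h h1, h2⟩

end

namespace Scheme

variable (I : Scheme)

/-- The registers that do not change during the search. -/
structure Ready (w a e : ℕ) (ρ : ℕ → ℕ) : Prop where
  r0 : ρ 0 = a
  r3 : ρ 3 = w
  r4 : ρ 4 = I.b
  r5 : ρ 5 = e
  r6 : ρ 6 = I.numFields * (32 * I.b)
  r7 : ρ 7 = I.tbl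
  r8 : ρ 8 = I.dir

variable {I} {w n σ a e : ℕ} {S : Fin n → Fin σ} {ρ : ℕ → ℕ} {E E' : Expr} {u v : ℕ}

namespace Valid

variable (hI : I.Valid) (hw : 33 * I.b ≤ w)
include hI hw

/-- The general guard against overflow: the intermediate numbers are polynomial in `2 ^ b`, and the
slack between `32 * b` and `33 * b` absorbs additive terms. -/
theorem lt_two_pow {v : ℕ} (hv : v ≤ 2 ^ (32 * I.b)) : v + 1 < 2 ^ w := by
  have h1 := hI.b_pos
  have h2 : 2 ^ (33 * I.b) ≤ 2 ^ w := Nat.pow_le_pow_right (by norm_num) hw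
  have h3 : 2 ^ (32 * I.b + 1) ≤ 2 ^ (33 * I.b) := Nat.pow_le_pow_right (by norm_num) (by omega)
  have h4 : 2 ^ (32 * I.b + 1) = 2 * 2 ^ (32 * I.b) := by ring
  have h5 : 2 ^ 1 < 2 ^ (32 * I.b) := Nat.pow_lt_pow_right (by norm_num) (by omega)
  omega

theorem small {v : ℕ} (hv : v ≤ 1000) : v < 2 ^ w := by
  have h1 := hI.b_pos
  have h2 : 2 ^ 32 ≤ 2 ^ (32 * I.b) := Nat.pow_le_pow_right (by norm_num) (by omega)
  have := hI.lt_two_pow hw (v := v) (by omega)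
  omega

theorem payload_lt {v : ℕ} (hv : v ≤ I.payload.length) : v + 1 < 2 ^ w :=
  hI.lt_two_pow hw (hv.trans (hI.length_le.trans
    (Nat.pow_le_pow_right (by norm_num) (by omega))))

theorem evals_const {c : ℕ} (hc : c ≤ 1000) : Evals (w := w) S I.index ρ (.const c) c :=
  RangeMode.evals_const c (hI.small hw hc)

theorem fields_add_lt {v : ℕ} (hv : v ≤ 2 ^ (31 * I.b)) :
    I.numFields * (32 * I.b) + v + 1 < 2 ^ w := by
  apply hI.lt_two_pow hw
  have h1 := hI.numFields_le
  have h2 : 2 ^ (30 * I.b) ≤ 2 ^ (31 * I.b) := Nat.pow_le_pow_right (by norm_num) (by omega)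
  have h3 : 2 ^ (31 * I.b + 1) ≤ 2 ^ (32 * I.b) :=
    Nat.pow_le_pow_right (by norm_num) (by have := hI.b_pos; omega)
  have h4 : 2 ^ (31 * I.b + 1) = 2 * 2 ^ (31 * I.b) := by ring
  omega

theorem evals_fieldWidth (h4 : ρ 4 = I.b) :
    Evals (w := w) S I.index ρ fieldWidthExpr (32 * I.b) := by
  have hb := hI.b_pos
  exact (hI.evals_const hw (by norm_num)).mul (evals_reg_eq h4)
    (lt_of_le_of_lt (by omega : 32 * I.b ≤ w) Nat.lt_two_pow_self)

theorem evals_field (h3 : ρ 3 = w) (h4 : ρ 4 = I.b) (h : Evals (w := w) S I.index ρ E u)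
    (hu : u < I.numFields) : Evals (w := w) S I.index ρ (fieldExpr E) (I.field u) := by
  have hb := hI.b_pos
  have h1 : u * (32 * I.b) ≤ I.numFields * (32 * I.b) := Nat.mul_le_mul_right _ hu.le
  have h2 := hI.fields_add_lt hw (Nat.zero_le _)
  have hW := hI.evals_fieldWidth hw (S := S) h4
  exact ((h.mul hW (by omega)).bits h3 hW (by omega) (by omega)).cast (hI.bitsNat_field hu)

theorem evals_payload (h3 : ρ 3 = w) (h6 : ρ 6 = I.numFields * (32 * I.b))
    (h : Evals (w := w) S I.index ρ E u) (h' : Evals (w := w) S I.index ρ E' v)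
    (hu : u ≤ I.payload.length) (hv : v < w) :
    Evals (w := w) S I.index ρ (payloadExpr E E') (bitsNat I.zbit u v) := by
  have h2 := hI.fields_add_lt hw (hu.trans (hI.length_le.trans
    (Nat.pow_le_pow_right (by norm_num) (by omega : 20 * I.b ≤ 31 * I.b))))
  exact (((evals_reg_eq h6).add h (by omega)).bits h3 h' h2 hv).cast (I.bitsNat_payload _ _)

theorem evals_block (h4 : ρ 4 = I.b) : Evals (w := w) S I.index ρ blockExpr I.block := by
  have h1 : I.b < 2 ^ I.b := Nat.lt_two_pow_self
  have h2 : 2 ^ I.b ≤ 2 ^ (32 * I.b) := Nat.pow_le_pow_right (by norm_num) (by omega)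
  have h5 := hI.lt_two_pow hw (v := I.b) (by omega)
  exact ((evals_reg_eq h4).add (hI.evals_const hw (by norm_num)) h5).div
    (hI.evals_const hw (by norm_num))

theorem evals_rank (hR : I.Ready w a e ρ) (h : Evals (w := w) S I.index ρ E u)
    (hu : u ≤ I.payload.length) :
    Evals (w := w) S I.index ρ (rankExpr E) (rank I.zbit u) := by
  have hb := hI.b_pos
  have hB := hI.evals_block hw (S := S) hR.r4
  have hq := h.div hB
  have hmod := Nat.mod_lt u hI.block_pos
  have hdm := Nat.div_mul_le_self u I.block
  have hble : I.block ≤ I.b := by unfold block; omega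
  have hbits : bitsNat I.zbit (u / I.block * I.block) (u % I.block) < 2 ^ I.block :=
    (bitsNat_lt _ _ _).trans_le (Nat.pow_le_pow_right (by norm_num) hmod.le)
  have hf1 : I.dir + u / I.block < I.numFields :=
    Nat.lt_succ_of_le (Nat.add_le_add_left (Nat.div_le_div_right hu) _)
  have hf2 : I.tbl + bitsNat I.zbit (u / I.block * I.block) (u % I.block) < I.numFields :=
    (Nat.add_lt_add_left hbits I.tbl).trans_le
      ((Nat.le_add_right _ _).trans (Nat.le_add_right _ 1))
  have hn : ∀ i, i < I.numFields → i < 2 ^ w := fun i hi => by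
    have h1 : I.numFields * 1 ≤ I.numFields * (32 * I.b) := Nat.mul_le_mul_left _ (by omega)
    have h2 := hI.fields_add_lt hw (Nat.zero_le _)
    omega
  have hu2 := hI.payload_lt hw hu
  have e1 := hI.evals_field hw hR.r3 hR.r4 ((evals_reg_eq hR.r8).add hq (hn _ hf1)) hf1
  have e2 := hI.evals_field hw hR.r3 hR.r4 ((evals_reg_eq hR.r7).add
    (hI.evals_payload hw hR.r3 hR.r6 (hq.mul hB (by omega)) (h.mod hB) (by omega) (by omega))
    (hn _ hf2)) hf2
  -- The sum of the two fields is the rank itself, which is at most `u`, so the addition does not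
  -- overflow.
  have hr := rank_le I.zbit u
  rw [hI.rank_eq] at hr ⊢
  exact e1.add e2 (by omega)

theorem evals_count (hR : I.Ready w a e ρ) (h : Evals (w := w) S I.index ρ E u)
    (h' : Evals (w := w) S I.index ρ E' v) (huv : u + v ≤ I.payload.length) :
    Evals (w := w) S I.index ρ (countExpr E E') (rank I.zbit (u + v) - rank I.zbit u) := by
  have h1 := hI.payload_lt hw huv
  exact (hI.evals_rank hw hR (h.add h' (by omega)) huv).sub
    (hI.evals_rank hw hR h (by omega)) (Nat.count_monotone _ (Nat.le_add_right u v))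

theorem evals_mixed {l p : ℕ} (hR : I.Ready w a e ρ) (hl : l < I.L) (h10 : ρ 10 = I.flagOff l)
    (h12 : ρ 12 = p) (hp : p < I.card l) :
    Evals (w := w) S I.index ρ mixedExpr (decide (Mixed I.F (I.x l) (I.cell l p))).toNat := by
  have hb := hI.b_pos
  have h1 : I.flagOff l + p ≤ I.payload.length :=
    I.flagOff_add_le hl (by rw [length_levelBits]; omega)
  have h2 := hI.payload_lt hw h1
  exact (hI.evals_payload hw hR.r3 hR.r6 ((evals_reg_eq h10).add (evals_reg_eq h12) (by omega))
    (hI.evals_const hw (by norm_num)) h1 (by omega)).cast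
    (by rw [bitsNat_one, zbit_flag I hl hp])

end Valid

/-- The registers during the search on level `l`. -/
structure Searching (I : Scheme) (w a e l : ℕ) (ρ : ℕ → ℕ) : Prop where
  ready : I.Ready w a e ρ
  lt : l < I.L
  r9 : ρ 9 = I.x l
  r10 : ρ 10 = I.flagOff l
  r11 : ρ 11 = cellMax I.F (I.x l) (cellOf (I.x l) a e)
  r13 : ρ 13 = 6 + 3 * l
  card_lt : ρ 12 < I.card l
  cell_eq : I.cell l (ρ 12) = cellOf (I.x l) a e

namespace Valid

variable (hI : I.Valid) (hw : 33 * I.b ≤ w)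
include hI hw

theorem evals_pow (h : Evals (w := w) S I.index ρ E v) (hv : v ≤ I.b + 1) :
    Evals (w := w) S I.index ρ (.op .shl (.const 1) E) (2 ^ v) := by
  have hb := hI.b_pos
  have h1 : 2 ^ v ≤ 2 ^ (32 * I.b) := Nat.pow_le_pow_right (by norm_num) (by omega)
  have h2 := hI.lt_two_pow hw h1
  exact ((hI.evals_const hw (by norm_num)).shl h (by omega)).cast (one_mul _)

theorem runs_root (hae : a < e) (he : e < 2 ^ I.b) (hL : 0 < I.L) (hR : I.Ready w a e ρ)
    (r9 : ρ 9 = I.x 0) (r10 : ρ 10 = I.flagOff 0) (r13 : ρ 13 = 6) :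
    ∃ ρ', Runs w S I.index (assigns rootAssigns) ρ (assignsCost rootAssigns) ρ' ∧
      I.Searching w a e 0 ρ' := by
  have hb := hI.b_pos
  have hx := hI.x_le
  have ha : a < 2 ^ I.b := hae.trans he
  have hpx3 : 2 ^ (I.b - I.x 0) * 2 ^ I.x 0 = 2 ^ I.b := by
    rw [← pow_add, Nat.sub_add_cancel hx]
  have hpos : 0 < 2 ^ I.x 0 := by positivity
  have hA := div_two_pow_lt hx ha
  have hE := div_two_pow_lt hx he
  -- The largest window of the root cell starts at a multiple of `2 ^ x 0` and ends below `2 ^ b`,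
  -- so its frequency is a prefix count of a stored row.
  have hlast : e / 2 ^ I.x 0 * 2 ^ I.x 0 + (2 ^ I.x 0 - 1) < 2 ^ I.b := by
    rw [← hpx3]
    exact pair_lt hE (by omega)
  have hrow := pair_lt hA hlast
  have hlen : 2 ^ (I.b - I.x 0) * 2 ^ I.b ≤ I.payload.length := by
    rw [length_payload, add_assoc]; exact Nat.le_add_right _ _
  have hlt := hI.payload_lt hw hlen
  have e0 : ∀ {ρ : ℕ → ℕ}, ρ 0 = a → ρ 9 = I.x 0 →
      Evals (w := w) S I.index ρ (cellExpr (.reg 0) (.reg 9)) (a / 2 ^ I.x 0) :=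
    fun h0 h9 => (evals_reg_eq h0).cell (evals_reg_eq h9) (by omega)
  have e5 : ∀ {ρ : ℕ → ℕ}, ρ 5 = e → ρ 9 = I.x 0 →
      Evals (w := w) S I.index ρ (cellExpr (.reg 5) (.reg 9)) (e / 2 ^ I.x 0) :=
    fun h5 h9 => (evals_reg_eq h5).cell (evals_reg_eq h9) (by omega)
  have p9 := hI.evals_pow hw (S := S) (evals_reg_eq r9) (by omega)
  have p4 := hI.evals_pow hw (S := S) (evals_reg_eq hR.r4) (by omega)
  unfold rootAssigns
  refine exists_assigns_cons (hI.evals_count hw hR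
    ((e0 hR.r0 r9).mul p4 (by omega))
    (((e5 hR.r5 r9).mul p9 (by omega)).add
      (p9.sub (hI.evals_const hw (by norm_num)) (by omega)) (by omega)) (by omega)) ?_
  rw [I.rank_row hI.freq hA hlast]
  have hroot := rootIdx_lt (F := I.F) hx ha he
  have hroot2 : rootIdx I.b I.x a e < 2 ^ w := by
    rw [levelCard_zero] at hroot
    have : 2 ^ (I.b - I.x 0) * 2 ^ (I.b - I.x 0) ≤ 2 ^ (I.b - I.x 0) * 2 ^ I.b :=
      Nat.mul_le_mul_left _ (Nat.pow_le_pow_right (by norm_num) (by omega))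
    omega
  have hroot3 := hroot2
  unfold rootIdx at hroot3
  refine exists_assigns_cons (v := rootIdx I.b I.x a e) ?_ ?_
  · refine ((e0 (by simpa using hR.r0) (by simpa using r9)).mul (hI.evals_pow hw
      ((evals_reg_eq (v := I.b) (by simpa using hR.r4)).sub
        (evals_reg_eq (v := I.x 0) (by simpa using r9)) hx) (by omega))
          (lt_of_le_of_lt (Nat.le_add_right _ _) hroot3)).add
        (e5 (by simpa using hR.r5) (by simpa using r9)) hroot3
  · refine ⟨_, runs_assigns_nil, ?_⟩
    constructor
    · constructor <;> simp [hR.r0, hR.r3, hR.r4, hR.r5, hR.r6, hR.r7, hR.r8]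
    · exact hL
    · simpa using r9
    · simpa using r10
    · simp [cellMax, cellOf]
    · simpa using r13
    · simpa using hroot
    · simpa using levelCell_rootIdx (F := I.F) hx ha he

theorem runs_init (hae : a < e) (he : e < 2 ^ I.b) (hL : 0 < I.L) (h0 : ρ 0 = a)
    (h1 : ρ 1 + 1 = e) (h3 : ρ 3 = w) :
    ∃ ρ', Runs w S I.index (assigns initAssigns) ρ (assignsCost initAssigns) ρ' ∧
      I.Searching w a e 0 ρ' := by
  have hb := hI.b_pos
  have hx := hI.x_le
  have hpb : 2 ^ (I.b + 1) ≤ 2 ^ (32 * I.b) := Nat.pow_le_pow_right (by norm_num) (by omega)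
  have hpb2 : 2 ^ (I.b + 1) = 2 * 2 ^ I.b := by ring
  have hbig := hI.lt_two_pow hw le_rfl
  have hnf : ∀ i, i ≤ 7 → i < I.numFields := fun i hi => by
    have : I.tbl ≤ I.numFields :=
      ((Nat.le_add_right _ _).trans (Nat.le_add_right _ _)).trans (Nat.le_add_right _ 1)
    have h2 : 9 ≤ I.tbl := by unfold tbl; omega
    omega
  unfold initAssigns
  refine exists_assigns_cons (v := I.b) ?_ ?_
  · obtain ⟨z, hz, hz'⟩ := hI.decode_header (w := w) (by omega)
    have hd : Evals (w := w) S I.index ρ (.readIdx (.const 0)) (2 ^ (I.b + 1) * z + 2 ^ I.b) := by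
      have := (hI.evals_const hw (S := S) (ρ := ρ) (c := 0) (by norm_num)).readIdx
      exact this.cast (by rw [zero_mul, hz])
    have hpos : 0 < 2 ^ I.b := by positivity
    have hH : Evals (w := w) S I.index ρ headerExpr (2 ^ (I.b + 1)) := by
      have h2 := (hd.xor (hd.sub (hI.evals_const hw (c := 1) (by norm_num)) (by omega)))
      rw [xor_pred] at h2
      have h4 := h2.add (hI.evals_const hw (c := 1) (by norm_num)) (by omega)
      exact h4.cast (by omega)
    refine ((hd.div hH).mod hH).cast ?_
    have : (2 ^ (I.b + 1) * z + 2 ^ I.b) / 2 ^ (I.b + 1) = z := by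
      rw [Nat.mul_add_div (by positivity), Nat.div_eq_of_lt (by omega), add_zero]
    rw [this, hz']
  refine exists_assigns_cons (v := e) ?_ ?_
  · exact ((evals_reg_eq (v := ρ 1) (by simp)).add (hI.evals_const hw (by norm_num))
      (by omega)).cast h1
  refine exists_assigns_cons (hI.evals_field hw (u := 1) (by simpa using h3) (by simp)
    (hI.evals_const hw (by norm_num)) (hnf _ (by norm_num))) ?_
  refine exists_assigns_cons (hI.evals_field hw (u := 2) (by simpa using h3) (by simp)
    (hI.evals_const hw (by norm_num)) (hnf _ (by norm_num))) ?_
  refine exists_assigns_cons (hI.evals_field hw (u := 3) (by simpa using h3) (by simp)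
    (hI.evals_const hw (by norm_num)) (hnf _ (by norm_num))) ?_
  refine exists_assigns_cons (hI.evals_field hw (u := 6) (by simpa using h3) (by simp)
    (hI.evals_const hw (by norm_num)) (hnf _ (by norm_num))) ?_
  refine exists_assigns_cons (hI.evals_field hw (u := 7) (by simpa using h3) (by simp)
    (hI.evals_const hw (by norm_num)) (hnf _ (by norm_num))) ?_
  refine exists_assigns_cons (hI.evals_const hw (c := 6) (by norm_num)) ?_
  have f1 : I.field 1 = I.numFields * (32 * I.b) := by simp [field]
  have f2 : I.field 2 = I.tbl := by simp [field]
  have f3 : I.field 3 = I.dir := by simp [field]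
  have f6 : I.field 6 = I.x 0 := I.field_x hL
  have f7 : I.field 7 = I.flagOff 0 := I.field_flagOff hL
  rw [f1, f2, f3, f6, f7]
  refine hI.runs_root hw hae he hL ?_ (by simp) (by simp) (by simp)
  constructor <;> simp [h0, h3]

theorem runs_step {l : ℕ} (h : I.Searching w a e l ρ)
    (hm : Mixed I.F (I.x l) (I.cell l (ρ 12))) (hl : l + 1 < I.L) :
    ∃ ρ', Runs w S I.index (assigns stepAssigns) ρ (assignsCost stepAssigns) ρ' ∧
      I.Searching w a e (l + 1) ρ' := by
  obtain ⟨hR, hl0, r9, r10, r11, r13, hp, hcell⟩ := h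
  generalize r12 : ρ 12 = p at *
  have hb := hI.b_pos
  have hx := hI.x_le
  have hxl : I.x l ≤ I.b := (hI.anti (Nat.zero_le l)).trans hx
  have hxx : I.x (l + 1) ≤ I.x l := hI.anti (Nat.le_succ l)
  have hflag : I.flagOff l + p ≤ I.payload.length :=
    I.flagOff_add_le hl0 (by rw [length_levelBits]; omega)
  have hchild := childIdx_lt (x := I.x) a e hp hm
  have hcc := levelCell_childIdx hI.anti hcell hm
  have hpar := parentIdx_childIdx (x := I.x) a e hm
  have hdelta : I.delta (l + 1) (childIdx I.F I.b I.x l p a e) =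
      cellMax I.F (I.x l) (cellOf (I.x l) a e) -
        cellMax I.F (I.x (l + 1)) (cellOf (I.x (l + 1)) a e) := by
    rw [delta, hpar]
    simp only [cell] at *
    rw [hcc, hcell]
  have hwidth : I.width (l + 1) = I.x l + 1 := rfl
  have hdlt : I.delta (l + 1) (childIdx I.F I.b I.x l p a e) < 2 ^ I.width (l + 1) := by
    rw [hdelta]; exact hI.freq.sub_cellMax_lt _ _ _ _
  have hcell_le : I.flagOff (l + 1) + (I.card (l + 1) + I.card (l + 1) * I.width (l + 1)) ≤
      I.payload.length := I.flagOff_add_le hl (by rw [length_levelBits])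
  have hpair : childIdx I.F I.b I.x l p a e * I.width (l + 1) ≤
      I.card (l + 1) * I.width (l + 1) := Nat.mul_le_mul_right _ hchild.le
  have hanti := hI.freq.cellMax_anti hxx a e
  have hpl := hI.payload_lt hw le_rfl
  have hdoff : I.deltaOff (l + 1) = I.flagOff (l + 1) + I.card (l + 1) := rfl
  have hnf : ∀ i, i < 12 + 3 * l → i < I.numFields := fun i hi => by
    have : I.tbl ≤ I.numFields :=
      ((Nat.le_add_right _ _).trans (Nat.le_add_right _ _)).trans (Nat.le_add_right _ 1)
    have h2 : 12 + 3 * l ≤ I.tbl := by unfold tbl; omega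
    omega
  have hlb : 12 + 3 * l ≤ 1000 * I.b := by have := hI.L_le; omega
  have hlb' : 12 + 3 * l < 2 ^ w := by
    have h1 : I.b < 2 ^ I.b := Nat.lt_two_pow_self
    have h2 : 2 ^ (I.b + 10) ≤ 2 ^ (32 * I.b) := Nat.pow_le_pow_right (by norm_num) (by omega)
    have h3 : 2 ^ (I.b + 10) = 1024 * 2 ^ I.b := by ring
    have h4 := hI.lt_two_pow hw h2
    omega
  unfold stepAssigns
  refine exists_assigns_cons (hI.evals_count hw hR (evals_reg_eq r10) (evals_reg_eq r12) hflag) ?_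
  rw [I.rank_flag hl0 hp.le]
  refine exists_assigns_cons (v := 9 + 3 * l) ?_ ?_
  · exact ((evals_reg_eq (v := 6 + 3 * l) (by simpa using r13)).add
      (hI.evals_const hw (by norm_num)) (by omega)).cast (by omega)
  refine exists_assigns_cons (v := I.x (l + 1)) ?_ ?_
  · exact (hI.evals_field hw (by simpa using hR.r3) (by simpa using hR.r4)
      (evals_reg_eq (v := 9 + 3 * l) (by simp)) (hnf _ (by omega))).cast
        (by rw [← I.field_x hl]; congr 1; ring)
  refine exists_assigns_cons (v := childIdx I.F I.b I.x l p a e) ?_ ?_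
  · generalize hρ : Function.update (Function.update (Function.update ρ 14 _) 13 _) 15 _ = ρ1
    have q0 : ρ1 0 = a := by subst hρ; simpa using hR.r0
    have q5 : ρ1 5 = e := by subst hρ; simpa using hR.r5
    have q9 : ρ1 9 = I.x l := by subst hρ; simpa using r9
    have q14 : ρ1 14 = mixedCount I.F I.b I.x l p := by subst hρ; simp
    have q15 : ρ1 15 = I.x (l + 1) := by subst hρ; simp
    clear hρ
    have hs : Evals (w := w) S I.index ρ1 splitExpr (2 ^ (I.x l - I.x (l + 1))) :=
      hI.evals_pow hw ((evals_reg_eq q9).sub (evals_reg_eq q15) hxx) (by omega)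
    have hlt : childIdx I.F I.b I.x l p a e < 2 ^ w := by
      have : childIdx I.F I.b I.x l p a e < I.card (l + 1) := hchild
      omega
    have e14 := evals_reg_eq (w := w) (S := S) (D := I.index) q14
    have ea := ((evals_reg_eq (w := w) (S := S) (D := I.index) q0).cell (evals_reg_eq q15)
      (by omega)).mod hs
    have ee := ((evals_reg_eq (w := w) (S := S) (D := I.index) q5).cell (evals_reg_eq q15)
      (by omega)).mod hs
    unfold childIdx at hlt ⊢
    have hg : 0 < 2 ^ (I.x l - I.x (l + 1)) := by positivity
    -- All partial results of the Horner scheme are bounded by the final number of the child, so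
    -- none overflows.
    have hlt2 := lt_of_le_of_lt (Nat.le_add_right _ _) hlt
    have hlt3 := lt_of_le_of_lt (Nat.le_mul_of_pos_right _ hg) hlt2
    have hlt4 := lt_of_le_of_lt (Nat.le_add_right _ _) hlt3
    exact (((e14.mul hs hlt4).add ea hlt3).mul hs hlt2).add ee hlt
  refine exists_assigns_cons
    (v := cellMax I.F (I.x (l + 1)) (cellOf (I.x (l + 1)) a e)) ?_ ?_
  · generalize hρ : Function.update (Function.update (Function.update
      (Function.update ρ 14 _) 13 _) 15 _) 12 _ = ρ1
    have q3 : ρ1 3 = w := by subst hρ; simpa using hR.r3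
    have q4 : ρ1 4 = I.b := by subst hρ; simpa using hR.r4
    have q6 : ρ1 6 = I.numFields * (32 * I.b) := by subst hρ; simpa using hR.r6
    have q9 : ρ1 9 = I.x l := by subst hρ; simpa using r9
    have q11 : ρ1 11 = cellMax I.F (I.x l) (cellOf (I.x l) a e) := by subst hρ; simpa using r11
    have q12 : ρ1 12 = childIdx I.F I.b I.x l p a e := by subst hρ; simp
    have q13 : ρ1 13 = 9 + 3 * l := by subst hρ; simp
    clear hρ
    have e9 : Evals (w := w) S I.index ρ1 (.op .add (.reg 9) (.const 1)) (I.width (l + 1)) :=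
      (evals_reg_eq q9).add (hI.evals_const hw (by norm_num))
        (lt_trans (by omega : I.x l + 1 < w) Nat.lt_two_pow_self)
    have eoff : Evals (w := w) S I.index ρ1 (fieldExpr (.op .add (.reg 13) (.const 2)))
        (I.deltaOff (l + 1)) :=
      (hI.evals_field hw q3 q4 ((evals_reg_eq q13).add (hI.evals_const hw (by norm_num))
        (by omega)) (hnf _ (by omega))).cast (by rw [← I.field_deltaOff hl]; congr 1; ring)
    have em := (evals_reg_eq (w := w) (S := S) (D := I.index) q12).mul e9 (by omega)
    have ed := hI.evals_payload hw q3 q6 (eoff.add em (by omega)) e9 (by omega) (by omega)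
    rw [I.bitsNat_delta hl hchild hdlt, hdelta] at ed
    exact ((evals_reg_eq q11).sub ed (by omega)).cast (by omega)
  refine exists_assigns_cons (v := I.x (l + 1)) (evals_reg_eq (by simp)) ?_
  refine exists_assigns_cons (v := I.flagOff (l + 1)) ?_ ?_
  · exact (hI.evals_field hw (by simpa using hR.r3) (by simpa using hR.r4)
      ((evals_reg_eq (v := 9 + 3 * l) (by simp)).add (hI.evals_const hw (by norm_num))
        (by omega)) (hnf _ (by omega))).cast (by rw [← I.field_flagOff hl]; congr 1; ring)
  refine ⟨_, runs_assigns_nil, ?_⟩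
  constructor
  · constructor <;> simp [hR.r0, hR.r3, hR.r4, hR.r5, hR.r6, hR.r7, hR.r8]
  · exact hl
  · simp
  · simp
  · simp
  · simp; ring
  · simpa using hchild
  · simpa using hcc

theorem runs_loop_stop {l : ℕ} (h : I.Searching w a e l ρ)
    (hm : ¬ Mixed I.F (I.x l) (I.cell l (ρ 12))) :
    Runs w S I.index (.loop mixedExpr (assigns stepAssigns)) ρ (mixedExpr.cost + 1) ρ ∧
      ρ 11 = I.F a e := by
  have hmix := hI.evals_mixed hw (S := S) h.ready h.lt h.r10 rfl h.card_lt
  rw [decide_eq_false hm] at hmix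
  refine ⟨Runs.loopStop hmix, ?_⟩
  have := h.cell_eq
  simp only [cell] at this hm
  rw [h.r11, hI.freq.eq_cellMax]
  rwa [← this]

theorem runs_loop {l K : ℕ} (h : I.Searching w a e l ρ) (hK : l + K < I.L)
    (hlast : I.x (l + K) = 0) :
    ∃ t ρ', Runs w S I.index (.loop mixedExpr (assigns stepAssigns)) ρ t ρ' ∧
      t ≤ (K + 1) * (mixedExpr.cost + 1 + assignsCost stepAssigns) ∧
      I.Ready w a e ρ' ∧ ρ' 11 = I.F a e := by
  induction K generalizing l ρ with
  | zero =>
    have hm : ¬ Mixed I.F (I.x l) (I.cell l (ρ 12)) := by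
      -- A cell of side 1 contains a single window, hence is not mixed, and the loop must stop.
      have h0 : I.x l = 0 := hlast
      simp [Mixed, cellMin, cellMax, h0]
    obtain ⟨h1, h2⟩ := hI.runs_loop_stop hw (S := S) h hm
    exact ⟨_, ρ, h1, by omega, h.ready, h2⟩
  | succ K ih =>
    by_cases hm : Mixed I.F (I.x l) (I.cell l (ρ 12))
    · have hmix := hI.evals_mixed hw (S := S) h.ready h.lt h.r10 rfl h.card_lt
      rw [decide_eq_true hm] at hmix
      obtain ⟨ρ1, h1, h2⟩ := hI.runs_step hw (S := S) h hm (by omega)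
      obtain ⟨t, ρ2, h3, h4, h5⟩ := ih h2 (by omega) (by rw [← hlast]; congr 1; ring)
      refine ⟨_, ρ2, Runs.loopStep hmix (by simp) h1 h3, ?_, h5⟩
      rw [add_mul (K + 1)]
      omega
    · obtain ⟨h1, h2⟩ := hI.runs_loop_stop hw (S := S) h hm
      refine ⟨_, ρ, h1, ?_, h.ready, h2⟩
      exact le_trans (by omega) (Nat.le_mul_of_pos_left _ (Nat.succ_pos (K + 1)))

theorem runs_final (hR : I.Ready w a e ρ) (r11 : ρ 11 = I.F a e) (hf : 0 < I.F a e)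
    (hae : a < e) (he : e < 2 ^ I.b) :
    ∃ ρ', Runs w S I.index (assigns finalAssigns) ρ (assignsCost finalAssigns) ρ' ∧
      ρ' 14 = a + e ∧ ρ' 15 = curve I.F (I.F a e) (a + e) ∧
      ρ' 16 = (I.side (I.F a e) (a + e)).toNat := by
  have hb := hI.b_pos
  have hm := hI.freq.le a e
  generalize I.F a e = f at *
  -- The bits for frequency `f + 1` form segment number `f`.
  obtain ⟨f, rfl⟩ : ∃ k, f = k + 1 := ⟨f - 1, by omega⟩
  have hpb2 : 2 ^ (I.b + 1) = 2 * 2 ^ I.b := by ring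
  have hd : a + e < 2 ^ (I.b + 1) := by omega
  have hpair := pair_lt hm hd
  have hlen : I.sideOff + I.m * 2 ^ (I.b + 1) ≤ I.payload.length := by
    simp only [payload, List.length_append, sideOff, curveOff, length_diagBits]; omega
  have hlen' : I.curveOff + I.m * 2 ^ (I.b + 1) ≤ I.sideOff := by
    simp only [sideOff, length_diagBits]; omega
  have hlt := hI.payload_lt hw hlen
  have hpos : 0 < 2 ^ (I.b + 1) := by positivity
  have hnf : ∀ i, i ≤ 5 → i < I.numFields := fun i hi => by
    have : I.tbl ≤ I.numFields :=
      ((Nat.le_add_right _ _).trans (Nat.le_add_right _ _)).trans (Nat.le_add_right _ 1)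
    have h2 : 6 ≤ I.tbl := by unfold tbl; omega
    omega
  have f4 : I.field 4 = I.curveOff := by simp [field]
  have f5 : I.field 5 = I.sideOff := by simp [field]
  have ediag : ∀ {ρ : ℕ → ℕ}, ρ 11 = f + 1 → ρ 4 = I.b →
      Evals (w := w) S I.index ρ diagExpr (f * 2 ^ (I.b + 1)) := by
    intro ρ h11 h4
    have h1 : I.b + 1 < 2 ^ w := lt_trans (by omega : I.b + 1 < w) Nat.lt_two_pow_self
    have h2 := (evals_reg_eq (w := w) (S := S) (D := I.index) h11).sub
      (hI.evals_const hw (c := 1) (by norm_num)) (by omega)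
    exact (h2.cast (Nat.add_sub_cancel f 1)).mul (hI.evals_pow hw
      ((evals_reg_eq h4).add (hI.evals_const hw (by norm_num)) h1) le_rfl) (by omega)
  unfold finalAssigns
  refine exists_assigns_cons ((evals_reg_eq hR.r0).add (evals_reg_eq hR.r5) ?_) ?_
  · have : 2 ^ (I.b + 1) ≤ 2 ^ (32 * I.b) := Nat.pow_le_pow_right (by norm_num) (by omega)
    have := hI.lt_two_pow hw this
    omega
  refine exists_assigns_cons (v := curve I.F (f + 1) (a + e)) ?_ ?_
  · have hR' : I.Ready w a e (Function.update ρ 14 (a + e)) := by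
      constructor <;> simp [hR.r0, hR.r3, hR.r4, hR.r5, hR.r6, hR.r7, hR.r8]
    have h1 := (hI.evals_field hw hR'.r3 hR'.r4 (S := S)
      (hI.evals_const hw (c := 4) (by norm_num)) (hnf _ (by norm_num))).cast f4
    have h2 := h1.add (ediag (by simpa using r11) hR'.r4) (by omega)
    have h3 := hI.evals_count hw hR' h2 (evals_reg_eq (i := 14) (v := a + e) (by simp))
      (by omega)
    rwa [I.rank_curve (by omega) hd] at h3
  refine exists_assigns_cons (v := (I.side (f + 1) (a + e)).toNat) ?_ ?_
  · generalize hρ : Function.update (Function.update ρ 14 _) 15 _ = ρ1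
    have q3 : ρ1 3 = w := by subst hρ; simpa using hR.r3
    have q4 : ρ1 4 = I.b := by subst hρ; simpa using hR.r4
    have q6 : ρ1 6 = I.numFields * (32 * I.b) := by subst hρ; simpa using hR.r6
    have q11 : ρ1 11 = f + 1 := by subst hρ; simpa using r11
    have q14 : ρ1 14 = a + e := by subst hρ; simp
    clear hρ
    have h1 := (hI.evals_field hw q3 q4 (S := S)
      (hI.evals_const hw (c := 5) (by norm_num)) (hnf _ (by norm_num))).cast f5
    have h2 := h1.add ((ediag q11 q4).add (evals_reg_eq q14) (by omega)) (by omega)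
    have h3 := hI.evals_payload hw q3 q6 h2 (hI.evals_const hw (c := 1) (by norm_num)) (by omega)
      (by omega)
    rwa [bitsNat_one, I.zbit_side (by omega) hd] at h3
  exact ⟨_, runs_assigns_nil, by simp, by simp, by simp⟩

end Valid

/-- The position of a mode. -/
def modePos (I : Scheme) (a e : ℕ) : ℕ :=
  bif I.side (I.F a e) (a + e) then curve I.F (I.F a e) (a + e) - 1
  else a + e - curve I.F (I.F a e) (a + e)

/-- A bound for the number of steps of a query, relative to the number of levels. -/
def stepBound : ℕ :=
  assignsCost initAssigns + (mixedExpr.cost + 1 + assignsCost stepAssigns) +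
    assignsCost finalAssigns + (Expr.reg 16).cost + 1 +
    ((Expr.readStr (.op .sub (.reg 15) (.const 1))).cost + 1) +
    ((Expr.readStr (.op .sub (.reg 14) (.reg 15))).cost + 1)

theorem Valid.runs_query (hI : I.Valid) (hw : 33 * I.b ≤ w) (hf : 0 < I.F a e) (hae : a < e)
    (he : e < 2 ^ I.b) (h0 : ρ 0 = a) (h1 : ρ 1 + 1 = e) (h3 : ρ 3 = w) :
    ∃ t ρ', Runs w S I.index queryProgram ρ t ρ' ∧ t ≤ I.L * stepBound ∧
      ρ' 0 = (strWord w S (I.modePos a e)).toNat := by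
  obtain ⟨K, hK, hlast⟩ := hI.last
  obtain ⟨ρ1, hr1, hs⟩ := hI.runs_init hw (S := S) hae he (by omega) h0 h1 h3
  obtain ⟨t, ρ2, hr2, ht, hR, r11⟩ := hI.runs_loop hw (S := S) hs (K := K) (by omega)
    (by rwa [zero_add])
  obtain ⟨ρ3, hr3, r14, r15, r16⟩ := hI.runs_final hw (S := S) hR r11 hf hae he
  have hpos : a < curve I.F (I.F a e) (a + e) :=
    (hI.freq.le_iff_lt_curve hf _ _).1 (by rw [Nat.add_sub_cancel_left])
  -- Needed so that the subtraction in the answer does not wrap around; a larger threshold would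
  -- give an empty window positive frequency.
  have hle : curve I.F (I.F a e) (a + e) ≤ a + e := by
    have h4 := (hI.freq.le_iff_lt_curve hf (a + e) (curve I.F (I.F a e) (a + e) - 1)).2 (by omega)
    by_contra hc
    have h5 : I.F (curve I.F (I.F a e) (a + e) - 1)
      (a + e - (curve I.F (I.F a e) (a + e) - 1)) = 0 := hI.freq.empty (by omega)
    omega
  have hfinal : ∃ t ρ', Runs w S I.index answerProgram ρ3 t ρ' ∧
      t ≤ (Expr.reg 16).cost + 1 +
        ((Expr.readStr (.op .sub (.reg 15) (.const 1))).cost + 1) +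
        ((Expr.readStr (.op .sub (.reg 14) (.reg 15))).cost + 1) ∧
      ρ' 0 = (strWord w S (I.modePos a e)).toNat := by
    unfold modePos answerProgram
    have e16 := evals_reg_eq (w := w) (S := S) (D := I.index) r16
    cases hside : I.side (I.F a e) (a + e)
    · rw [hside] at e16
      refine ⟨_, _, Runs.condFalse e16 (Runs.set
        ((evals_reg_eq r14).sub (evals_reg_eq r15) hle).readStr), by omega, by simp⟩
    · rw [hside] at e16
      refine ⟨_, _, Runs.condTrue e16 (by simp) (Runs.set
        ((evals_reg_eq r15).sub (hI.evals_const hw (by norm_num)) (by omega)).readStr),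
        by omega, by simp⟩
  obtain ⟨t', ρ4, hr4, ht', hres⟩ := hfinal
  refine ⟨_, ρ4, hr1.seq (hr2.seq (hr3.seq hr4)), ?_, hres⟩
  have h5 : (K + 1) * stepBound ≤ I.L * stepBound := Nat.mul_le_mul_right _ hK
  refine le_trans ?_ h5
  unfold stepBound
  generalize mixedExpr.cost + 1 + assignsCost stepAssigns = B at *
  generalize assignsCost initAssigns = A1 at *
  generalize assignsCost finalAssigns = A2 at *
  generalize (Expr.reg 16).cost = c1 at *
  generalize Expr.cost (Expr.readStr _) = c2 at *
  generalize Expr.cost (Expr.readStr _) = c3 at *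
  nlinarith [Nat.zero_le K, Nat.zero_le (K * A1), Nat.zero_le (K * A2), Nat.zero_le (K * c1),
    Nat.zero_le (K * c2), Nat.zero_le (K * c3)]

end Scheme

/-! ### Frequencies in a string -/

section

variable {n σ : ℕ} (S : Fin n → Fin σ)

/-- The number of occurrences of `c` in the window `[a, e)`. -/
def windowCount (c : Fin σ) (a e : ℕ) : ℕ :=
  (Finset.univ.filter fun i : Fin n => a ≤ i.val ∧ i.val < e ∧ S i = c).card

/-- The frequency of a mode of the window `[a, e)`. -/
def windowFreq (a e : ℕ) : ℕ := Finset.univ.sup fun i : Fin n => windowCount S (S i) a e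

theorem windowCount_mono (c : Fin σ) {a a' e e' : ℕ} (ha : a' ≤ a) (he : e ≤ e') :
    windowCount S c a e ≤ windowCount S c a' e' := by
  refine Finset.card_le_card fun i hi => ?_
  simp only [Finset.mem_filter, Finset.mem_univ, true_and] at hi ⊢
  exact ⟨ha.trans hi.1, hi.2.1.trans_le he, hi.2.2⟩

theorem card_filter_val_le_one (p : ℕ) :
    (Finset.univ.filter fun i : Fin n => i.val = p).card ≤ 1 := by
  refine Finset.card_le_one.2 fun i hi j hj => ?_
  simp only [Finset.mem_filter, Finset.mem_univ, true_and] at hi hj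
  exact Fin.ext (hi.trans hj.symm)

theorem windowCount_succ_right (c : Fin σ) (a e : ℕ) :
    windowCount S c a (e + 1) ≤ windowCount S c a e + 1 := by
  refine le_trans ?_ (Nat.add_le_add_left (card_filter_val_le_one (n := n) e) _)
  refine le_trans (Finset.card_le_card fun i hi => ?_) (Finset.card_union_le _ _)
  simp only [Finset.mem_filter, Finset.mem_univ, true_and, Finset.mem_union] at hi ⊢
  by_cases h : i.val = e
  · exact Or.inr h
  · exact Or.inl ⟨hi.1, by omega, hi.2.2⟩

theorem windowCount_succ_left (c : Fin σ) (a e : ℕ) :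
    windowCount S c a e ≤ windowCount S c (a + 1) e + 1 := by
  refine le_trans ?_ (Nat.add_le_add_left (card_filter_val_le_one (n := n) a) _)
  refine le_trans (Finset.card_le_card fun i hi => ?_) (Finset.card_union_le _ _)
  simp only [Finset.mem_filter, Finset.mem_univ, true_and, Finset.mem_union] at hi ⊢
  by_cases h : i.val = a
  · exact Or.inr h
  · exact Or.inl ⟨by omega, hi.2⟩

theorem windowCount_eq_zero (c : Fin σ) {a e : ℕ} (h : e ≤ a) : windowCount S c a e = 0 := by
  rw [windowCount, Finset.card_eq_zero, Finset.filter_eq_empty_iff]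
  intro i _ hi
  omega

theorem windowCount_le_windowFreq (c : Fin σ) (a e : ℕ) :
    windowCount S c a e ≤ windowFreq S a e := by
  by_cases h : ∃ i, S i = c
  · obtain ⟨i, rfl⟩ := h
    exact Finset.le_sup (f := fun i : Fin n => windowCount S (S i) a e) (Finset.mem_univ i)
  · rw [windowCount, Finset.filter_eq_empty_iff.2 fun i _ hi => h ⟨i, hi.2.2⟩]
    exact Nat.zero_le _

theorem exists_windowCount {f a e : ℕ} (hf : 0 < f) (h : f ≤ windowFreq S a e) :
    ∃ c, f ≤ windowCount S c a e := by
  obtain ⟨i, -, hi⟩ := (Finset.le_sup_iff (by simpa using hf)).1 h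
  exact ⟨S i, hi⟩

theorem windowCount_le_maxFreq (i : Fin n) (a e : ℕ) : windowCount S (S i) a e ≤ maxFreq S := by
  refine le_trans ?_ (Finset.le_sup (f := fun i => (Finset.univ.val.map S).count (S i))
    (Finset.mem_univ i))
  rw [Multiset.count_map]
  change _ ≤ (Finset.univ.filter fun j => S i = S j).card
  refine Finset.card_le_card fun j hj => ?_
  simp only [Finset.mem_filter, Finset.mem_univ, true_and] at hj ⊢
  exact hj.2.2.symm

theorem windowFreq_spec : WindowFreq (windowFreq S) (maxFreq S) where
  mono ha he := Finset.sup_mono_fun fun i _ => windowCount_mono S (S i) ha he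
  succ_right a e := Finset.sup_le fun i _ => (windowCount_succ_right S (S i) a e).trans
    (Nat.add_le_add_right (windowCount_le_windowFreq S _ _ _) 1)
  succ_left a e := Finset.sup_le fun i _ => (windowCount_succ_left S (S i) a e).trans
    (Nat.add_le_add_right (windowCount_le_windowFreq S _ _ _) 1)
  empty h := Nat.eq_zero_of_le_zero
    (Finset.sup_le fun i _ => (windowCount_eq_zero S (S i) h).le)
  le a e := Finset.sup_le fun i _ => windowCount_le_maxFreq S i a e

theorem count_substring (l r : Fin n) (c : Fin σ) :
    (substring S l r).count c = windowCount S c l (r + 1) := by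
  rw [substring, Multiset.count_map]
  change ((Finset.Icc l r).filter fun i => c = S i).card = _
  rw [windowCount]
  congr 1
  ext i
  simp only [Finset.mem_filter, Finset.mem_univ, true_and, Finset.mem_Icc, Fin.le_def,
    Nat.lt_succ_iff, and_assoc, eq_comm]

theorem maxFreq_pos (hn : 0 < n) : 0 < maxFreq S := by
  refine lt_of_lt_of_le ?_ (windowCount_le_maxFreq S ⟨0, hn⟩ 0 n)
  refine Finset.card_pos.2 ⟨⟨0, hn⟩, ?_⟩
  simp

theorem maxFreq_le : maxFreq S ≤ n := by
  refine Finset.sup_le fun i _ => ?_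
  refine (Multiset.count_le_card _ _).trans ?_
  simp

/-- Whether the first character of a minimal window that has a mode of frequency `f` occurs `f`
times in this window. -/
def sideBit (f d : ℕ) : Bool :=
  decide (∃ i : Fin n, i.val = curve (windowFreq S) f d - 1 ∧
    f ≤ windowCount S (S i) (curve (windowFreq S) f d - 1)
      (d - (curve (windowFreq S) f d - 1)))

/-- The minimal window `[A, d - A)` of frequency at least `f` lies in `[a, e)`, so a character with
`f` occurrences there is a mode of `[a, e)`. It remains to see that an end of the minimal window
carries one. -/
theorem modePos_spec {I : Scheme} (hF : I.F = windowFreq S) (hside : I.side = sideBit S)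
    {a e : ℕ} (hf : 0 < windowFreq S a e) :
    ∃ i : Fin n, i.val = I.modePos a e ∧ a ≤ i.val ∧ i.val < e ∧
      windowFreq S a e ≤ windowCount S (S i) a e := by
  have hspec := windowFreq_spec S
  have hpos : a < curve (windowFreq S) (windowFreq S a e) (a + e) :=
    (hspec.le_iff_lt_curve hf _ _).1 (by rw [Nat.add_sub_cancel_left])
  have h1 := (hspec.le_iff_lt_curve hf (a + e)
    (curve (windowFreq S) (windowFreq S a e) (a + e) - 1)).2 (by omega)
  have h2 := (hspec.le_iff_lt_curve hf (a + e)
    (curve (windowFreq S) (windowFreq S a e) (a + e))).not.2 (lt_irrefl _)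
  unfold Scheme.modePos
  rw [hF, hside]
  unfold sideBit
  generalize windowFreq S a e = f at *
  generalize curve (windowFreq S) f (a + e) = A at *
  obtain ⟨A, rfl⟩ : ∃ k, A = k + 1 := ⟨A - 1, by omega⟩
  simp only [Nat.add_sub_cancel] at *
  have hAe : A < a + e - A := by
    by_contra hc
    have := hspec.empty (not_lt.1 hc)
    omega
  by_cases hs : ∃ i : Fin n, i.val = A ∧ f ≤ windowCount S (S i) A (a + e - A)
  · obtain ⟨i, hi, hc⟩ := hs
    refine ⟨i, ?_, by omega, by omega, hc.trans (windowCount_mono S _ (by omega) (by omega))⟩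
    have hs' : ∃ i : Fin n, i.val = A ∧ f ≤ windowCount S (S i) A (a + e - A) := ⟨i, hi, hc⟩
    simp only [hs', decide_true, cond_true, hi]
  · simp only [hs, decide_false, cond_false]
    obtain ⟨c, hc⟩ := exists_windowCount S hf h1
    have h3 := windowCount_le_windowFreq S c (A + 1) (a + e - (A + 1))
    -- By minimality `c` loses an occurrence when both ends are removed. If the left end does not
    -- qualify, the lost occurrence is at the right end.
    have h4 : windowCount S c (A + 1) (a + e - (A + 1)) < windowCount S c A (a + e - A) := by
      omega
    unfold windowCount at h4
    obtain ⟨j, hj, hj'⟩ := Finset.exists_mem_notMem_of_card_lt_card h4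
    simp only [Finset.mem_filter, Finset.mem_univ, true_and] at hj hj'
    obtain ⟨hj1, hj2, rfl⟩ := hj
    have hjA : j.val ≠ A := fun h => hs ⟨j, h, hc⟩
    refine ⟨j, ?_, by omega, by omega, hc.trans (windowCount_mono S _ (by omega) (by omega))⟩
    by_contra hne
    exact hj' ⟨by omega, by omega, rfl⟩

end

/-! ### Sizes of cells -/

/-- The logarithms of the sizes of cells: each is about three quarters of the previous one, and
the last one is `0`. -/
def cellLog (x₀ K l : ℕ) : ℕ := if l ≤ K then (fun x => x - x / 4)^[l] x₀ else 0

theorem cellLog_zero (x₀ K : ℕ) : cellLog x₀ K 0 = x₀ := by simp [cellLog]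

theorem cellLog_succ {x₀ K l : ℕ} (h : l < K) :
    cellLog x₀ K (l + 1) = cellLog x₀ K l - cellLog x₀ K l / 4 := by
  simp only [cellLog, if_pos h.le, if_pos (Nat.succ_le_of_lt h), Function.iterate_succ_apply']

theorem cellLog_last (x₀ K : ℕ) : cellLog x₀ K (K + 1) = 0 := by simp [cellLog]

theorem antitone_cellLog (x₀ K : ℕ) : Antitone (cellLog x₀ K) := by
  refine antitone_nat_of_succ_le fun l => ?_
  rcases lt_or_ge l K with h | h
  · rw [cellLog_succ h]; exact Nat.sub_le _ _
  · have : ¬ l + 1 ≤ K := by omega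
    simp [cellLog, this]

/-- While the value is at least 4, each round takes off at least one; at 3 or below it is
stationary. -/
theorem iterate_le_max (x₀ K : ℕ) : (fun x => x - x / 4)^[K] x₀ ≤ max 3 (x₀ - K) := by
  induction K with
  | zero => simp
  | succ K ih =>
    rw [Function.iterate_succ_apply']
    generalize (fun x => x - x / 4)^[K] x₀ = y at *
    omega

/-- Rounding turns the factor `3 / 4` into `y ↦ (3 * y + 3) / 4`, whose fixed point 3 is the
additive error. -/
theorem iterate_le (x₀ K : ℕ) :
    (((fun x => x - x / 4)^[K] x₀ : ℕ) : ℝ) ≤ (3 / 4 : ℝ) ^ K * x₀ + 3 := by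
  induction K with
  | zero => simp
  | succ K ih =>
    rw [Function.iterate_succ_apply']
    generalize (fun x => x - x / 4)^[K] x₀ = y at *
    have h : 4 * (y - y / 4) ≤ 3 * y + 3 := by omega
    have h' : (4 : ℝ) * ((y - y / 4 : ℕ) : ℝ) ≤ 3 * y + 3 := by exact_mod_cast h
    rw [pow_succ]
    linarith

/-- Three rounds at least halve the main term, as `(3 / 4) ^ 3 ≤ 1 / 2`; `3 * (2 ^ k + 1)` rounds
divide it by `2 * 2 ^ 2 ^ k`, the extra 2 being spent on `4 ^ y = 2 ^ (2 * y)`. The additive error 3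
gives the factor 64. If `b` rounds are made instead, the value is at most 3 anyway. -/
theorem four_pow_cellLog_le {x₀ b k : ℕ} (hx : x₀ ≤ b) {q : ℝ} (hq : (2 : ℝ) ^ x₀ ≤ q) :
    (4 : ℝ) ^ cellLog x₀ (min (3 * 2 ^ k + 3) b) (min (3 * 2 ^ k + 3) b) ≤
      64 * q ^ ((1 : ℝ) / (2 : ℝ) ^ (2 ^ k : ℕ)) := by
  have hq1 : 1 ≤ q := le_trans (one_le_pow₀ (by norm_num)) hq
  have hexp : 0 ≤ (1 : ℝ) / (2 : ℝ) ^ (2 ^ k : ℕ) := by positivity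
  have hq2 : 1 ≤ q ^ ((1 : ℝ) / (2 : ℝ) ^ (2 ^ k : ℕ)) := Real.one_le_rpow hq1 hexp
  simp only [cellLog, if_pos le_rfl]
  rcases le_total (3 * 2 ^ k + 3) b with h | h
  · rw [min_eq_left h]
    have h1 := iterate_le x₀ (3 * 2 ^ k + 3)
    generalize (fun x => x - x / 4)^[3 * 2 ^ k + 3] x₀ = y at *
    have h2 : (3 / 4 : ℝ) ^ (3 * 2 ^ k + 3) ≤ (1 / 2 : ℝ) ^ (2 ^ k + 1) := by
      rw [show 3 * 2 ^ k + 3 = 3 * (2 ^ k + 1) by ring, pow_mul]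
      exact pow_le_pow_left₀ (by norm_num) (by norm_num) _
    have h3 : (2 : ℝ) * y ≤ x₀ * ((1 : ℝ) / (2 : ℝ) ^ (2 ^ k : ℕ)) + 6 := by
      have h4 := mul_le_mul_of_nonneg_right h2 (Nat.cast_nonneg x₀ : (0 : ℝ) ≤ x₀)
      rw [pow_succ (1 / 2 : ℝ), one_div_pow] at h4
      linarith
    calc (4 : ℝ) ^ y = (2 : ℝ) ^ ((2 : ℝ) * y) := by
          rw [Real.rpow_mul (by norm_num), Real.rpow_natCast]; norm_num
      _ ≤ (2 : ℝ) ^ (x₀ * ((1 : ℝ) / (2 : ℝ) ^ (2 ^ k : ℕ)) + 6) :=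
          Real.rpow_le_rpow_of_exponent_le (by norm_num) h3
      _ = 64 * ((2 : ℝ) ^ x₀) ^ ((1 : ℝ) / (2 : ℝ) ^ (2 ^ k : ℕ)) := by
          rw [Real.rpow_add (by norm_num), Real.rpow_mul (by norm_num), Real.rpow_natCast]
          norm_num [mul_comm]
      _ ≤ _ := by
          gcongr
  · rw [min_eq_right h]
    have h1 := iterate_le_max x₀ b
    have h2 : (fun x => x - x / 4)^[b] x₀ ≤ 3 := by omega
    calc (4 : ℝ) ^ ((fun x => x - x / 4)^[b] x₀) ≤ 4 ^ 3 :=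
          pow_le_pow_right₀ (by norm_num) h2
      _ = 64 := by norm_num
      _ ≤ _ := by linarith

/-- Why a quarter is taken off: a mixed cell gets about `2 ^ (x / 2)` subcells of `x + 2` bits, and
the remaining factor `2 ^ (x / 2)` pays for `x + 2`. -/
theorem add_two_mul_le (x : ℕ) : 2 ^ (x / 4) * 2 ^ (x / 4) * (x + 2) ≤ 4 * 2 ^ x := by
  have h1 : x / 2 < 2 ^ (x / 2) := Nat.lt_two_pow_self
  calc 2 ^ (x / 4) * 2 ^ (x / 4) * (x + 2) ≤ 2 ^ (x / 2) * (4 * 2 ^ (x / 2)) := by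
        refine Nat.mul_le_mul ?_ (by omega)
        rw [← pow_add]
        exact Nat.pow_le_pow_right (by norm_num) (by omega)
    _ = 4 * 2 ^ (x / 2 + x / 2) := by ring
    _ ≤ 4 * 2 ^ x := Nat.mul_le_mul_left _ (Nat.pow_le_pow_right (by norm_num) (by omega))

/-! ### Size of the index. -/

namespace Scheme

variable {I : Scheme}

theorem length_payload_le {K : ℕ} (hF : WindowFreq I.F I.m) (hx : I.x = cellLog (I.x 0) K)
    (hb : I.x 0 ≤ I.b) (hL : I.L = K + 2) (hm : 2 ^ (I.b - I.x 0) ≤ 4 * I.m) :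
    I.payload.length ≤ I.m * 2 ^ I.b * (16 + 8 * K + 4 * 4 ^ I.x K) := by
  have hanti : Antitone I.x := hx ▸ antitone_cellLog _ _
  have hpow : ∀ l, 2 ^ (I.b - I.x l) * 2 ^ I.x l = 2 ^ I.b := fun l => by
    rw [← pow_add, Nat.sub_add_cancel ((hanti (Nat.zero_le l)).trans hb)]
  have hx2 : ∀ x : ℕ, x + 2 ≤ 2 * 2 ^ x := fun x => by
    have : x < 2 ^ x := Nat.lt_two_pow_self
    omega
  have hterm : ∀ l, I.card l + I.card l * I.width l = I.card l * (I.x (l - 1) + 2) := fun l => by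
    rw [width]; ring
  have hsucc : ∀ l, I.card (l + 1) ≤ I.m * (2 * 2 ^ (I.b - I.x l)) *
      (2 ^ (I.x l - I.x (l + 1)) * 2 ^ (I.x l - I.x (l + 1))) := fun l =>
    (levelCard_succ I.F I.b I.x l).le.trans (Nat.mul_le_mul_right _ (mixedCount_le hF hanti hb))
  -- Level 0 has all cells of the grid: one factor `2 ^ (b - x 0)` is at most `4 * m`, the other
  -- combines with the width to `O(2 ^ b)`.
  have t0 : I.card 0 * (I.x 0 + 2) ≤ 8 * (I.m * 2 ^ I.b) := by
    rw [card, levelCard_zero]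
    calc 2 ^ (I.b - I.x 0) * 2 ^ (I.b - I.x 0) * (I.x 0 + 2)
        ≤ (4 * I.m) * 2 ^ (I.b - I.x 0) * (2 * 2 ^ I.x 0) :=
          Nat.mul_le_mul (Nat.mul_le_mul_right _ hm) (hx2 _)
      _ = 8 * (I.m * (2 ^ (I.b - I.x 0) * 2 ^ I.x 0)) := by ring
      _ = _ := by rw [hpow]
  have t1 : ∀ l < K, I.card (l + 1) * (I.x l + 2) ≤ 8 * (I.m * 2 ^ I.b) := by
    intro l hl
    have hg : I.x l - I.x (l + 1) = I.x l / 4 := by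
      rw [hx, cellLog_succ hl]; omega
    have h1 := hsucc l
    rw [hg] at h1
    calc I.card (l + 1) * (I.x l + 2)
        ≤ I.m * (2 * 2 ^ (I.b - I.x l)) * (2 ^ (I.x l / 4) * 2 ^ (I.x l / 4)) * (I.x l + 2) :=
          Nat.mul_le_mul_right _ h1
      _ = I.m * (2 * 2 ^ (I.b - I.x l)) *
            (2 ^ (I.x l / 4) * 2 ^ (I.x l / 4) * (I.x l + 2)) := by ring
      _ ≤ I.m * (2 * 2 ^ (I.b - I.x l)) * (4 * 2 ^ I.x l) :=
          Nat.mul_le_mul_left _ (add_two_mul_le _)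
      _ = 8 * (I.m * (2 ^ (I.b - I.x l) * 2 ^ I.x l)) := by ring
      _ = _ := by rw [hpow]
  -- The last level splits down to side 1; only here does the factor `4 ^ x K` appear.
  have t2 : I.card (K + 1) * (I.x K + 2) ≤ 4 * (I.m * 2 ^ I.b) * 4 ^ I.x K := by
    have hg : I.x K - I.x (K + 1) = I.x K := by
      have : I.x (K + 1) = 0 := by rw [hx]; exact cellLog_last _ _
      omega
    have h1 := hsucc K
    rw [hg] at h1
    have h4 : 4 ^ I.x K = 2 ^ I.x K * 2 ^ I.x K := by rw [← mul_pow]; norm_num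
    calc I.card (K + 1) * (I.x K + 2)
        ≤ I.m * (2 * 2 ^ (I.b - I.x K)) * (2 ^ I.x K * 2 ^ I.x K) * (2 * 2 ^ I.x K) :=
          Nat.mul_le_mul h1 (hx2 _)
      _ = 4 * (I.m * (2 ^ (I.b - I.x K) * 2 ^ I.x K)) * (2 ^ I.x K * 2 ^ I.x K) := by ring
      _ = _ := by rw [hpow, h4]
  have hsum : ∑ l ∈ Finset.range I.L, (I.card l + I.card l * I.width l) ≤
      8 * (I.m * 2 ^ I.b) + K * (8 * (I.m * 2 ^ I.b)) + 4 * (I.m * 2 ^ I.b) * 4 ^ I.x K := by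
    rw [hL, Finset.sum_range_succ, Finset.sum_range_succ', hterm, hterm, Nat.zero_sub,
      Nat.add_sub_cancel]
    have h1 : ∑ l ∈ Finset.range K, (I.card (l + 1) + I.card (l + 1) * I.width (l + 1)) ≤
        K * (8 * (I.m * 2 ^ I.b)) := by
      have := Finset.sum_le_card_nsmul (Finset.range K)
        (fun l => I.card (l + 1) + I.card (l + 1) * I.width (l + 1)) (8 * (I.m * 2 ^ I.b))
        fun l hl => by
          simp only [hterm, Nat.add_sub_cancel]
          exact t1 l (Finset.mem_range.1 hl)
      simpa using this
    omega
  have hrow : 2 ^ (I.b - I.x 0) * 2 ^ I.b ≤ 4 * (I.m * 2 ^ I.b) := by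
    rw [← mul_assoc]; exact Nat.mul_le_mul_right _ hm
  have hdiag : 2 * (I.m * 2 ^ (I.b + 1)) = 4 * (I.m * 2 ^ I.b) := by ring
  rw [length_payload, hdiag]
  calc _ ≤ 4 * (I.m * 2 ^ I.b) + 4 * (I.m * 2 ^ I.b) +
        (8 * (I.m * 2 ^ I.b) + K * (8 * (I.m * 2 ^ I.b)) + 4 * (I.m * 2 ^ I.b) * 4 ^ I.x K) := by
        omega
    _ = _ := by ring

/-- With blocks of about `b / 2` bits, the table has only about `2 ^ (b / 2)` fields, and the
directory spends at most 64 bits per payload bit. The other constants are `416 = 32 * 13` and `96 =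
32 * 3`. -/
theorem length_index_le {K : ℕ} (hb : 0 < I.b) (hL : I.L = K + 2) :
    I.index.length ≤ 416 * I.b + 96 * (I.b * K) + 96 * 2 ^ I.b + 65 * I.payload.length := by
  have h1 : I.b ≤ 3 * 2 ^ (I.b / 2) := by
    have : I.b / 2 < 2 ^ (I.b / 2) := Nat.lt_two_pow_self
    omega
  have h2 : I.b * 2 ^ I.block ≤ 3 * 2 ^ I.b := by
    calc I.b * 2 ^ I.block ≤ 3 * 2 ^ (I.b / 2) * 2 ^ I.block := Nat.mul_le_mul_right _ h1
      _ = 3 * 2 ^ (I.b / 2 + I.block) := by rw [pow_add]; ring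
      _ = 3 * 2 ^ I.b := by congr 2; unfold block; omega
  have h3 : I.b * (I.payload.length / I.block) ≤ 2 * I.payload.length := by
    calc I.b * (I.payload.length / I.block)
        ≤ 2 * I.block * (I.payload.length / I.block) :=
          Nat.mul_le_mul_right _ (by unfold block; omega)
      _ = 2 * (I.block * (I.payload.length / I.block)) := by ring
      _ ≤ _ := Nat.mul_le_mul_left _ (Nat.mul_div_le _ _)
  rw [length_index, numFields, dir, tbl, hL]
  generalize I.payload.length / I.block = q at *
  calc (6 + 3 * (K + 2) + 2 ^ I.block + q + 1) * (32 * I.b) + I.payload.length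
      = 416 * I.b + 96 * (I.b * K) + 32 * (I.b * 2 ^ I.block) + 32 * (I.b * q) +
        I.payload.length := by ring
    _ ≤ _ := by omega

end Scheme

/-- The scheme for a string. -/
def scheme {n σ : ℕ} (S : Fin n → Fin σ) (k : ℕ) : Scheme where
  F := windowFreq S
  side := sideBit S
  m := maxFreq S
  b := Nat.log 2 n + 1
  x := cellLog (Nat.log 2 (n / maxFreq S)) (min (3 * 2 ^ k + 3) (Nat.log 2 n + 1))
  L := min (3 * 2 ^ k + 3) (Nat.log 2 n + 1) + 2

/-! ### The scheme of a string: validity and size. -/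

section

variable {n σ : ℕ} (S : Fin n → Fin σ) (k : ℕ)

theorem scheme_x_zero : (scheme S k).x 0 = Nat.log 2 (n / maxFreq S) :=
  cellLog_zero _ (min (3 * 2 ^ k + 3) (Nat.log 2 n + 1))

theorem log_div_le : Nat.log 2 (n / maxFreq S) ≤ Nat.log 2 n + 1 :=
  (Nat.log_mono_right (Nat.div_le_self _ _)).trans (Nat.le_succ _)

theorem two_pow_b_le (hn : 0 < n) : 2 ^ (scheme S k).b ≤ 2 * n := by
  have := Nat.pow_log_le_self 2 hn.ne'
  simp only [scheme, pow_succ]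
  omega

theorem lt_two_pow_b : n < 2 ^ (scheme S k).b := Nat.lt_pow_succ_log_self (by norm_num) n

theorem length_payload_scheme (hn : 0 < n) : (scheme S k).payload.length ≤
    maxFreq S * 2 ^ (scheme S k).b * (16 + 8 * min (3 * 2 ^ k + 3) (Nat.log 2 n + 1) +
      4 * 4 ^ (scheme S k).x (min (3 * 2 ^ k + 3) (Nat.log 2 n + 1))) := by
  refine Scheme.length_payload_le (windowFreq_spec S) ?_ ?_ rfl ?_
  · rw [scheme_x_zero]; rfl
  · rw [scheme_x_zero]; exact log_div_le S
  -- Here `2 ^ b ≤ 2 * n` and `n < m * 2 ^ (x 0 + 1)`, which gives the factor 4.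
  · have hm := maxFreq_pos S hn
    have hdiv : 0 < n / maxFreq S := Nat.div_pos (maxFreq_le S) hm
    have h1 : n / maxFreq S < 2 ^ (Nat.log 2 (n / maxFreq S) + 1) :=
      Nat.lt_pow_succ_log_self (by norm_num) _
    have h2 := (Nat.div_lt_iff_lt_mul hm).1 h1
    have h3 := two_pow_b_le S k hn
    have h4 : 2 ^ ((scheme S k).b - (scheme S k).x 0) * 2 ^ (scheme S k).x 0 =
        2 ^ (scheme S k).b := by
      rw [← pow_add, Nat.sub_add_cancel]
      rw [scheme_x_zero]; exact log_div_le S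
    rw [← scheme_x_zero S k, pow_succ] at h2
    refine Nat.le_of_mul_le_mul_right (c := 2 ^ (scheme S k).x 0) ?_ (by positivity)
    rw [h4]
    change _ ≤ 4 * maxFreq S * _
    nlinarith

/-- Capping the number of rounds at `Nat.log 2 n + 1` keeps all addresses polynomial in `n` for
every `k`; the word size is tied to `n` only. -/
theorem scheme_valid (hn : 0 < n) : (scheme S k).Valid where
  freq := windowFreq_spec S
  anti := antitone_cellLog _ _
  x_le := by rw [scheme_x_zero]; exact log_div_le S
  b_pos := Nat.succ_pos _
  L_le := Nat.add_le_add_right (min_le_right _ _) 2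
  last := ⟨_, Nat.lt_succ_self _, cellLog_last _ _⟩
  length_le := by
    refine (length_payload_scheme S k hn).trans ?_
    have hx : (scheme S k).x (min (3 * 2 ^ k + 3) (Nat.log 2 n + 1)) ≤ (scheme S k).b :=
      (antitone_cellLog _ _ (Nat.zero_le _)).trans (by
        rw [cellLog_zero]; exact log_div_le S)
    have h4 : 4 ^ (scheme S k).x (min (3 * 2 ^ k + 3) (Nat.log 2 n + 1)) ≤
        2 ^ (scheme S k).b * 2 ^ (scheme S k).b := by
      rw [← mul_pow]; exact Nat.pow_le_pow_right (by norm_num) hx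
    have hK : min (3 * 2 ^ k + 3) (Nat.log 2 n + 1) ≤ 2 ^ (scheme S k).b :=
      (min_le_right _ _).trans (Nat.lt_two_pow_self (n := (scheme S k).b)).le
    have hm : maxFreq S ≤ 2 ^ (scheme S k).b := (maxFreq_le S).trans (lt_two_pow_b S k).le
    have h2 : 2 ≤ 2 ^ (scheme S k).b :=
      Nat.le_self_pow (n := (scheme S k).b) (Nat.succ_ne_zero _) 2
    rw [mul_comm 20, pow_mul]
    generalize 2 ^ (scheme S k).b = B at *
    calc _ ≤ B * B * (16 + 8 * B + 4 * (B * B)) := by gcongr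
      _ ≤ B * B * (2 ^ 4 * (B * B)) := by
          refine Nat.mul_le_mul_left _ ?_
          nlinarith
      _ ≤ B * B * (B ^ 4 * (B * B)) := by gcongr
      _ = B ^ 8 := by ring
      _ ≤ B ^ 20 := Nat.pow_le_pow_right (by omega) (by norm_num)

theorem length_index_scheme (hn : 0 < n) : ((scheme S k).index.length : ℝ) ≤
    42784 * ((4 : ℝ) ^ k * n * maxFreq S *
      ((n : ℝ) / maxFreq S) ^ ((1 : ℝ) / (2 : ℝ) ^ (2 ^ k : ℕ))) := by
  have hm := maxFreq_pos S hn
  have h1 := Scheme.length_index_le (I := scheme S k) (scheme_valid S k hn).b_pos rfl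
  have h2 := length_payload_scheme S k hn
  have h3 := two_pow_b_le S k hn
  have h4 : (scheme S k).b ≤ n := Nat.log_lt_self 2 hn.ne'
  have h5 : (2 : ℝ) ^ (scheme S k).x 0 ≤ (n : ℝ) / maxFreq S := by
    rw [scheme_x_zero]
    have h6 := Nat.pow_log_le_self 2 (Nat.div_pos (maxFreq_le S) hm).ne'
    have h7 : ((2 ^ Nat.log 2 (n / maxFreq S) : ℕ) : ℝ) ≤ ((n / maxFreq S : ℕ) : ℝ) := by
      exact_mod_cast h6
    push_cast at h7
    exact h7.trans Nat.cast_div_le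
  have hq1 : 1 ≤ ((n : ℝ) / maxFreq S) ^ ((1 : ℝ) / (2 : ℝ) ^ (2 ^ k : ℕ)) :=
    Real.one_le_rpow (le_trans (one_le_pow₀ (by norm_num)) h5) (by positivity)
  have h8 : (4 : ℝ) ^ (scheme S k).x (min (3 * 2 ^ k + 3) (Nat.log 2 n + 1)) ≤
      64 * ((n : ℝ) / maxFreq S) ^ ((1 : ℝ) / (2 : ℝ) ^ (2 ^ k : ℕ)) := by
    rw [scheme_x_zero] at h5
    exact four_pow_cellLog_le (log_div_le S) h5
  have hK : min (3 * 2 ^ k + 3) (Nat.log 2 n + 1) ≤ 6 * 4 ^ k := by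
    have h9 : 2 ^ k ≤ 4 ^ k := Nat.pow_le_pow_left (by norm_num) k
    have h10 : 1 ≤ 4 ^ k := Nat.one_le_pow _ _ (by norm_num)
    omega
  generalize ((n : ℝ) / maxFreq S) ^ ((1 : ℝ) / (2 : ℝ) ^ (2 ^ k : ℕ)) = q at *
  generalize hX : 4 ^ (scheme S k).x (min (3 * 2 ^ k + 3) (Nat.log 2 n + 1)) = X at *
  have h8' : (X : ℝ) ≤ 64 * q := by rw [← hX]; push_cast; exact h8
  generalize min (3 * 2 ^ k + 3) (Nat.log 2 n + 1) = K at *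
  generalize maxFreq S = m at *
  have h11 : (scheme S k).index.length ≤ n * m * (2688 + 1136 * K + 520 * X) := by
    have e1 : (scheme S k).b ≤ n * m := h4.trans (Nat.le_mul_of_pos_right _ hm)
    have e2 : 2 ^ (scheme S k).b ≤ 2 * (n * m) :=
      h3.trans (Nat.mul_le_mul_left _ (Nat.le_mul_of_pos_right _ hm))
    calc _ ≤ _ := h1
      _ ≤ 416 * (n * m) + 96 * (n * m * K) + 96 * (2 * (n * m)) +
          65 * (m * (2 * n) * (16 + 8 * K + 4 * X)) := by
          gcongr
          exact h2.trans (Nat.mul_le_mul_right _ (Nat.mul_le_mul_left _ h3))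
      _ = _ := by ring
  have h12 : ((scheme S k).index.length : ℝ) ≤ n * m * (2688 + 1136 * K + 520 * X) := by
    exact_mod_cast h11
  have hK' : (K : ℝ) ≤ 6 * 4 ^ k := by exact_mod_cast hK
  have h4k : (1 : ℝ) ≤ 4 ^ k := one_le_pow₀ (by norm_num)
  -- Here `42784 = 2688 + 6 * 1136 + 64 * 520`, from `K ≤ 6 * 4 ^ k` and `X ≤ 64 * q`; both `4 ^ k`
  -- and `q` are at least 1.
  have h13 : (2688 + 1136 * K + 520 * X : ℝ) ≤ 42784 * (4 ^ k * q) := by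
    nlinarith [mul_nonneg (sub_nonneg.2 h4k) (sub_nonneg.2 hq1)]
  calc _ ≤ _ := h12
    _ ≤ n * m * (42784 * (4 ^ k * q)) := by gcongr
    _ = _ := by ring

end

end RangeMode

theorem mainTheorem2 :
    ∃ (P : RangeMode.Program) (c a : ℕ), ∀ (k n σ w : ℕ), 0 < n →
      a * (Nat.log 2 n + 1) ≤ w → σ ≤ 2 ^ w → ∀ S : Fin n → Fin σ,
        ∃ D : List Bool,
          (D.length : ℝ) ≤ (c : ℝ) * ((4 : ℝ) ^ k * (n : ℝ) * (RangeMode.maxFreq S : ℝ) *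
            ((n : ℝ) / (RangeMode.maxFreq S : ℝ)) ^ ((1 : ℝ) / (2 : ℝ) ^ (2 ^ k : ℕ))) ∧
          RangeMode.AnswersRangeMode P w S D (c * 2 ^ k) := by
  -- The constant serves space and time at once; the 8 comes from `L ≤ 3 * 2 ^ k + 5 ≤ 8 * 2 ^ k`.
  -- The 33 leaves room for fields of `32 * b` bits.
  refine ⟨RangeMode.queryProgram, 42784 + 8 * RangeMode.Scheme.stepBound, 33, ?_⟩
  intro k n σ w hn hw hσ S
  have hI := RangeMode.scheme_valid S k hn
  refine ⟨(RangeMode.scheme S k).index, ?_, ?_⟩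
  · refine (RangeMode.length_index_scheme S k hn).trans ?_
    refine mul_le_mul_of_nonneg_right ?_ (by positivity)
    push_cast
    have : (0 : ℝ) ≤ RangeMode.Scheme.stepBound := Nat.cast_nonneg _
    linarith
  intro l r hlr
  have hnb := RangeMode.lt_two_pow_b S k
  have hbw : 2 ^ (RangeMode.scheme S k).b ≤ 2 ^ w :=
    Nat.pow_le_pow_right (by norm_num) (le_trans (Nat.le_mul_of_pos_left _ (by norm_num)) hw)
  have hl := l.isLt
  have hr := r.isLt
  have hf : 0 < RangeMode.windowFreq S l (r + 1) := by
    refine lt_of_lt_of_le ?_ (RangeMode.windowCount_le_windowFreq S (S l) l (r + 1))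
    exact Finset.card_pos.2 ⟨l, by simp; omega⟩
  obtain ⟨i, hi, hil, hir, hcount⟩ :=
    RangeMode.modePos_spec S (I := RangeMode.scheme S k) rfl rfl hf
  obtain ⟨t, ρ', hrun, ht, hres⟩ := hI.runs_query (w := w) (S := S) (a := l) (e := r + 1)
    (ρ := fun j => ((RangeMode.initState w n l r).reg j).toNat) hw hf (by omega) (by omega)
    (by simp [RangeMode.initState]; exact Nat.mod_eq_of_lt (by omega))
    (by simp [RangeMode.initState]; exact Nat.mod_eq_of_lt (by omega))
    (by simp [RangeMode.initState])
  obtain ⟨s, hexec, hs⟩ := hrun (RangeMode.initState w n l r) fun _ => rfl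
  refine ⟨t, s, hexec, ht.trans ?_, S i, ⟨?_, fun y => ?_⟩, ?_⟩
  · have h1 : (RangeMode.scheme S k).L ≤ 8 * 2 ^ k := by
      have h2 : 1 ≤ 2 ^ k := Nat.one_le_two_pow
      have h3 : (RangeMode.scheme S k).L ≤ 3 * 2 ^ k + 3 + 2 :=
        Nat.add_le_add_right (min_le_left _ _) 2
      omega
    refine (Nat.mul_le_mul_right _ h1).trans ?_
    rw [add_mul]
    refine le_trans (le_of_eq ?_) (Nat.le_add_left _ _)
    ring
  · refine Multiset.mem_map.2 ⟨i, ?_, rfl⟩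
    rw [Finset.mem_val, Finset.mem_Icc, Fin.le_def, Fin.le_def]
    omega
  · rw [RangeMode.count_substring, RangeMode.count_substring]
    exact (RangeMode.windowCount_le_windowFreq S y _ _).trans hcount
  · rw [hs 0, hres, ← hi, RangeMode.strWord, dif_pos i.isLt, BitVec.toNat_ofNat]
    exact Nat.mod_eq_of_lt ((S i).isLt.trans_le hσ)
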